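/- Let $\mu$ be a probability distribution on $(-\infty,+\infty]$ with $\mu(\{+\infty\})<1$, and suppose that for $\omega\sim\mu$ and every $\beta\in(0,\infty)$ $$\psi(\beta):=\log\mathbb{E}\,e^{-\beta\omega}<\infty ,\qquad e^{-\infty}:=0 .$$ For each $n\ge 1$ let $E_n$ be the edge set of the complete bipartite graph $K_{n,n}$, let $\omega=(\omega_e)_{e\in E_n}$ be i.i.d. weights with law $\mu$, and let $\mathcal{M}_n$ be the set of perfect matchings of $K_{n,n}$. For $\pi\in\mathcal{M}_n$ put $W(\pi)=\sum_{e\in\pi}\omega_e$, and define the Gibbs measure at inverse temperature $\beta$ by $$P_{\beta,\omega}(\pi)=\frac{1}{Z_n(\beta,\omega)}\cdot\frac1{n!}\,e^{-\beta W(\pi)},\qquad Z_n(\beta,\omega)=\frac1{n!}\sum_{\pi\in\mathcal{M}_n}e^{-\beta W(\pi)} .$$ (If $Z_n(\beta,\omega)=0$, set $P_{\beta,\omega}:=0$.) Theorem 1.2. Fix $\beta\in(0,\infty)$ and, given $\omega$, let $\pi_1,\pi_2$ be independent samples from $P_{\beta,\omega}$. Then the law of the number of common edges $|\pi_1\cap\pi_2|$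 given $\omega$ converges weakly, in probability with respect to $\omega$, to the Poisson distribution with mean $\lambda=e^{\psi(2\beta)-2\psi(\beta)}$. That is, for every bounded function $f:\mathbb{N}\to\mathbb{R}$, as $n\to\infty$, $$\sum_{\pi_1,\pi_2\in\mathcal{M}_n}P_{\beta,\omega}(\pi_1)\,P_{\beta,\omega}(\pi_2)\,f\bigl(|\pi_1\cap\pi_2|\bigr)\;\longrightarrow\;\sum_{k\ge0}e^{-\lambda}\frac{\lambda^k}{k!}\,f(k)\quad\text{in probability.}$$ -/

import Mathlib

open MeasureTheory ProbabilityTheory Filter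
open scoped ENNReal NNReal BoundedContinuousFunction

namespace MMP

/-- The edges of the complete bipartite graph `K_{n,n}`: the pair `(i, j)` is the edge joining the
`i`-th vertex of the left side to the `j`-th vertex of the right side. -/
abbrev Edge (n : ℕ) : Type := Fin n × Fin n

/-- A set of edges of `K_{n,n}` is a perfect matching if every vertex, on the left and on the
right, belongs to exactly one of its edges. -/
def IsPerfectMatching {n : ℕ} (M : Finset (Edge n)) : Prop :=
  (∀ i : Fin n, ∃! j : Fin n, (i, j) ∈ M) ∧ (∀ j : Fin n, ∃! i : Fin n, (i, j) ∈ M)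

open Classical in
/-- The set of all perfect matchings of `K_{n,n}`. -/
noncomputable def perfectMatchings (n : ℕ) : Finset (Finset (Edge n)) :=
  Finset.univ.filter IsPerfectMatching

/-- The total weight `W(M) = ∑_{e ∈ M} w_e`. Weights are extended reals, since an edge may have
weight `+∞`. -/
noncomputable def totalWeight {n : ℕ} (w : Edge n → EReal) (M : Finset (Edge n)) : EReal :=
  ∑ e ∈ M, w e

/-- The partition function `Z(β, w) = (1 / n!) ∑_M exp (-β W(M))`, with `exp (-∞) = 0`. -/
noncomputable def partitionFunction {n : ℕ} (β : ℝ) (w : Edge n → EReal) : ℝ≥0∞ :=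
  (n.factorial : ℝ≥0∞)⁻¹ *
    ∑ M ∈ perfectMatchings n, EReal.exp (-(β : EReal) * totalWeight w M)

/-- The Gibbs probability `(1 / Z(β, w)) (1 / n!) exp (-β W(M))` of a perfect matching `M`.
(If every perfect matching has infinite weight, then `Z(β, w) = 0`, there is no Gibbs measure and
this is `0`.) -/
noncomputable def gibbsProb {n : ℕ} (β : ℝ) (w : Edge n → EReal) (M : Finset (Edge n)) : ℝ≥0∞ :=
  (n.factorial : ℝ≥0∞)⁻¹ * EReal.exp (-(β : EReal) * totalWeight w M) / partitionFunction β w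

/-- The law, for given weights `w`, of the number of common edges of two perfect matchings sampled
independently from the Gibbs measure: the pair `(M₁, M₂)` has probability
`gibbsProb β w M₁ * gibbsProb β w M₂`. -/
noncomputable def overlapLaw {n : ℕ} (β : ℝ) (w : Edge n → EReal) : Measure ℕ :=
  ∑ M₁ ∈ perfectMatchings n, ∑ M₂ ∈ perfectMatchings n,
    (gibbsProb β w M₁ * gibbsProb β w M₂) • Measure.dirac (M₁ ∩ M₂).card

/-- `ψ(β) = log E[exp (-β ω)]` for a weight `ω` with law `μ`, as an extended real. -/
noncomputable def psi (μ : Measure EReal) (β : ℝ) : EReal :=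
  ENNReal.log (∫⁻ x, EReal.exp (-(β : EReal) * x) ∂μ)

/-- The rate `exp (ψ(2β) - 2ψ(β))`. -/
noncomputable def overlapRate (μ : Measure EReal) (β : ℝ) : ℝ≥0 :=
  (EReal.exp (psi μ (2 * β) - 2 * psi μ β)).toNNReal

/-- Convergence in probability of random measures `ν n` on `ℕ` to a deterministic one, for the
weak topology: the integral of every bounded (continuous) function converges in probability. -/
def TendstoWeaklyInProbability {Ω : Type*} [MeasurableSpace Ω] (P : Measure Ω)
    (ν : ℕ → Ω → Measure ℕ) (ν' : Measure ℕ) : Prop :=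
  ∀ f : ℕ →ᵇ ℝ, TendstoInMeasure P (fun n a => ∫ k, f k ∂(ν n a)) atTop (fun _ => ∫ k, f k ∂ν')

end MMP

/-! Divide the Boltzmann factors by their mean, which leaves the Gibbs measure unchanged: the edges
carry independent x_e ≥ 0 with E x = 1 and E x² = λ. Two uniform permutations agree in about
Poisson(1) places, and a common edge contributes λ to E[weight(ρ) weight(τ)]. Reweighting Poisson(1)
by λ^k gives Poisson(λ). This is the averaged statement; the work is to get it for typical weights.

Let Z be the average permutation weight (`avgWeight`). It does not concentrate in general, since E
Z² → e^{λ-1}, so it is compared with the random product Q = ∏ (1 + (x_e - 1)/n) (`edgeProd`). All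
three terms of E(Z - Q)² tend to e^{λ-1} up to sign and multiplicity, so Z - Q → 0 in L². The bound
E[1/Q] ≤ e^{2(λ-1)} (`integral_inv_edgeProd_le`) keeps Q, hence Z, away from 0.

For s ≥ 0 the generating function of the overlap is the ρ-average of weight(ρ) times
`tiltedAvgWeight` s x ρ, over Z². With c = e^{λ(s-1)}, the ρ-average of E[weight(ρ) (tilted - cQ)²]
tends to 0 (`tendsto_integral_tiltedDefect`), and Cauchy-Schwarz over ρ yields convergence in
probability to c, the Poisson generating function. An approximation argument
(`OverlapConverges.of_bounded`) passes to all bounded test functions.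

By independence the moments become averages over permutations of products ∏ (1 + C i (τ i)). The
combinatorial engine is `tendsto_permAvg_prod_one_add_sub_exp`: such an average is asymptotically
exp of the mean row sum of C, uniformly when absolute row and column sums are bounded. -/

namespace MMP

open Finset Topology

/-! ### Permanents of bounded perturbations of the all-ones matrix. -/

/-- The average of a function over all permutations of `Fin n`. -/
noncomputable def permAvg {n : ℕ} (f : Equiv.Perm (Fin n) → ℝ) : ℝ :=
  (∑ σ, f σ) / n.factorial

/-- The unnormalised `k`-th coefficient of `t ↦ perm (1 + t C)`. -/
noncomputable def permCoeff {n : ℕ} (C : Fin n → Fin n → ℝ) (k : ℕ) : ℝ :=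
  ∑ τ : Equiv.Perm (Fin n), ∑ S ∈ powersetCard k univ, ∏ i ∈ S, C i (τ i)

/-- Double counting: a (k+1)-set with a marked element is a k-set with a marked element of its
complement. -/
theorem sum_powersetCard_succ_mul {α : Type*} [Fintype α] [DecidableEq α] (k : ℕ)
    (f : Finset α → ℝ) :
    (k + 1) * ∑ S ∈ powersetCard (k + 1) univ, f S =
      ∑ S ∈ powersetCard k univ, ∑ i ∈ Sᶜ, f (insert i S) := by
  have h : (k + 1) * ∑ S ∈ powersetCard (k + 1) univ, f S =
      ∑ S ∈ powersetCard (k + 1) (univ : Finset α), ∑ _i ∈ S, f S := by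
    rw [mul_sum]
    refine sum_congr rfl fun S hS => ?_
    rw [sum_const, (mem_powersetCard.1 hS).2, nsmul_eq_mul]
    push_cast
    rfl
  rw [h, sum_sigma', sum_sigma']
  refine sum_bij' (fun p _ => ⟨p.1.erase p.2, p.2⟩) (fun p _ => ⟨insert p.2 p.1, p.2⟩) ?_ ?_ ?_ ?_ ?_
  · rintro ⟨S, i⟩ h
    simp only [mem_sigma, mem_powersetCard, subset_univ, true_and, mem_compl] at h ⊢
    refine ⟨?_, by simp⟩
    rw [card_erase_of_mem h.2, h.1]
    rfl
  · rintro ⟨S, i⟩ h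
    simp only [mem_sigma, mem_powersetCard, subset_univ, true_and, mem_compl] at h ⊢
    refine ⟨?_, by simp⟩
    rw [card_insert_of_notMem h.2, h.1]
  · rintro ⟨S, i⟩ h
    simp only [mem_sigma, mem_powersetCard, subset_univ, true_and] at h ⊢
    simp [insert_erase h.2]
  · rintro ⟨S, i⟩ h
    simp only [mem_sigma, mem_powersetCard, subset_univ, true_and, mem_compl] at h ⊢
    simp [erase_insert h.2]
  · rintro ⟨S, i⟩ h
    simp only [mem_sigma, mem_powersetCard, subset_univ, true_and] at h ⊢
    simp [insert_erase h.2]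

/-- Rows outside S are exchangeable: precomposing τ with the transposition of i and i' does not
affect the product over S. -/
theorem sum_perm_mul_prod_eq {n : ℕ} (C : Fin n → Fin n → ℝ) (S : Finset (Fin n)) (c : Fin n → ℝ)
    {i i' : Fin n} (hi : i ∉ S) (hi' : i' ∉ S) :
    ∑ τ : Equiv.Perm (Fin n), c (τ i) * ∏ k ∈ S, C k (τ k) =
      ∑ τ : Equiv.Perm (Fin n), c (τ i') * ∏ k ∈ S, C k (τ k) := by
  rw [← Equiv.sum_comp (Equiv.mulRight (Equiv.swap i i'))]
  refine sum_congr rfl fun τ _ => ?_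
  simp only [Equiv.coe_mulRight, Equiv.Perm.coe_mul, Function.comp_apply, Equiv.swap_apply_left]
  congr 1
  refine prod_congr rfl fun k hk => ?_
  rw [Equiv.swap_apply_of_ne_of_ne (ne_of_mem_of_not_mem hk hi) (ne_of_mem_of_not_mem hk hi')]

/-- By exchangeability, the factor of row i may be averaged over all n - |S| rows outside S, at the
columns that τ assigns to them. -/
theorem card_sub_mul_sum_perm_prod_insert {n : ℕ} (C : Fin n → Fin n → ℝ) (S : Finset (Fin n))
    {i : Fin n} (hi : i ∉ S) :
    ((n : ℝ) - S.card) * ∑ τ : Equiv.Perm (Fin n), ∏ k ∈ insert i S, C k (τ k) =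
      ∑ τ : Equiv.Perm (Fin n), (∑ i' ∈ Sᶜ, C i (τ i')) * ∏ k ∈ S, C k (τ k) := by
  have hc : ((n : ℝ) - S.card) = (Sᶜ.card : ℝ) := by
    rw [card_compl, Fintype.card_fin, Nat.cast_sub (by simpa using card_le_univ S)]
  simp_rw [prod_insert hi, sum_mul]
  rw [sum_comm, hc, ← nsmul_eq_mul, ← sum_const]
  refine sum_congr rfl fun i' hi' => ?_
  exact sum_perm_mul_prod_eq C S (C i) hi (by simpa using hi')

/-- Each row added to S costs at most a factor R / (n - |S|), because the columns still free carry
at most a full row sum. -/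
theorem sum_perm_prod_le {n : ℕ} {C : Fin n → Fin n → ℝ} (hC : ∀ i j, 0 ≤ C i j) {R : ℝ}
    (hR : 0 ≤ R) (hrow : ∀ i, ∑ j, C i j ≤ R) (S : Finset (Fin n)) :
    ∑ τ : Equiv.Perm (Fin n), ∏ k ∈ S, C k (τ k) ≤ R ^ S.card * (n - S.card).factorial := by
  induction S using Finset.induction_on with
  | empty => simp [Fintype.card_perm]
  | insert i S hi ih =>
    have hlt : S.card < n := by
      have := card_le_univ (insert i S)
      rw [card_insert_of_notMem hi, Fintype.card_fin] at this
      omega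
    have hpos : (0 : ℝ) < (n : ℝ) - S.card := by
      rw [sub_pos]; exact_mod_cast hlt
    have key := card_sub_mul_sum_perm_prod_insert C S hi
    refine le_of_mul_le_mul_left ?_ hpos
    rw [key, card_insert_of_notMem hi]
    calc _ ≤ ∑ τ : Equiv.Perm (Fin n), R * ∏ k ∈ S, C k (τ k) := by
          refine sum_le_sum fun τ _ => ?_
          refine mul_le_mul_of_nonneg_right ?_ (prod_nonneg fun k _ => hC _ _)
          refine le_trans ?_ (hrow i)
          rw [← Equiv.sum_comp τ (C i)]
          exact sum_le_univ_sum_of_nonneg fun j => hC _ _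
      _ ≤ R * (R ^ S.card * (n - S.card).factorial) := by
          rw [← mul_sum]
          exact mul_le_mul_of_nonneg_left ih hR
      _ = _ := by
          obtain ⟨m, hm⟩ := Nat.exists_eq_add_of_lt hlt
          have h1 : n - S.card = m + 1 := by omega
          have h2 : n - (S.card + 1) = m := by omega
          have h3 : (n : ℝ) - S.card = m + 1 := by
            have : (n : ℝ) = S.card + m + 1 := by exact_mod_cast hm
            linarith
          rw [h1, h2, h3, Nat.factorial_succ]
          push_cast
          ring

theorem permCoeff_abs_div_factorial_le {n : ℕ} {C : Fin n → Fin n → ℝ} {R : ℝ}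
    (hR : 0 ≤ R) (hrow : ∀ i, ∑ j, |C i j| ≤ R) (k : ℕ) :
    permCoeff (fun i j => |C i j|) k / n.factorial ≤ R ^ k / k.factorial := by
  rw [div_le_div_iff₀ (by positivity) (by positivity)]
  unfold permCoeff
  rw [sum_comm]
  by_cases hk : k ≤ n
  · calc _ ≤ (∑ S ∈ powersetCard k (univ : Finset (Fin n)), R ^ k * (n - k).factorial)
            * k.factorial := by
          refine mul_le_mul_of_nonneg_right (sum_le_sum fun S hS => ?_) (by positivity)
          have := sum_perm_prod_le (fun i j => abs_nonneg (C i j)) hR hrow S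
          rwa [(mem_powersetCard.1 hS).2] at this
      _ = _ := by
          rw [sum_const, card_powersetCard, card_univ, Fintype.card_fin, nsmul_eq_mul,
            ← Nat.choose_mul_factorial_mul_factorial hk]
          push_cast
          ring
  · rw [powersetCard_eq_empty.2 (by simpa using hk)]
    simp only [sum_empty, zero_mul]
    positivity

theorem abs_permCoeff_le {n : ℕ} (C : Fin n → Fin n → ℝ) (k : ℕ) :
    |permCoeff C k| ≤ permCoeff (fun i j => |C i j|) k := by
  refine (abs_sum_le_sum_abs _ _).trans (sum_le_sum fun τ _ => ?_)
  refine (abs_sum_le_sum_abs _ _).trans (sum_le_sum fun S _ => ?_)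
  rw [abs_prod]

theorem permAvg_prod_one_add {n : ℕ} (C : Fin n → Fin n → ℝ) :
    permAvg (fun τ => ∏ i, (1 + C i (τ i))) = ∑' k, permCoeff C k / n.factorial := by
  rw [tsum_eq_sum (s := range (n + 1))]
  · rw [← sum_div]
    unfold permAvg permCoeff
    congr 1
    rw [sum_comm]
    refine sum_congr rfl fun τ _ => ?_
    simp only [prod_one_add, sum_powerset, card_univ, Fintype.card_fin]
  · intro k hk
    have : n < k := by simpa using hk
    unfold permCoeff
    rw [powersetCard_eq_empty.2 (by simpa using this)]
    simp

/-- What is discarded lies in the |S| rows of S or the |S| columns of τ(S), each of absolute mass at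
most R. -/
theorem abs_sum_compl_sub_le {n : ℕ} {C : Fin n → Fin n → ℝ} {R : ℝ}
    (hrow : ∀ i, ∑ j, |C i j| ≤ R) (hcol : ∀ j, ∑ i, |C i j| ≤ R) (S : Finset (Fin n))
    (τ : Equiv.Perm (Fin n)) :
    |∑ i ∈ Sᶜ, ∑ i' ∈ Sᶜ, C i (τ i') - ∑ i, ∑ j, C i j| ≤ 2 * R * S.card := by
  have h1 : ∑ i, ∑ j, C i j = ∑ i ∈ Sᶜ, ∑ i' ∈ Sᶜ, C i (τ i') + ∑ i ∈ Sᶜ, ∑ i' ∈ S, C i (τ i')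
      + ∑ i ∈ S, ∑ j, C i j := by
    rw [← sum_add_distrib, ← sum_compl_add_sum S]
    congr 1
    refine sum_congr rfl fun i _ => ?_
    rw [sum_compl_add_sum, Equiv.sum_comp τ (C i)]
  have h2 : |∑ i ∈ S, ∑ j, C i j| ≤ S.card * R := by
    refine (abs_sum_le_sum_abs _ _).trans ?_
    rw [← nsmul_eq_mul]
    exact sum_le_card_nsmul _ _ _ fun i _ => (abs_sum_le_sum_abs _ _).trans (hrow i)
  have h3 : |∑ i ∈ Sᶜ, ∑ i' ∈ S, C i (τ i')| ≤ S.card * R := by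
    rw [sum_comm]
    refine (abs_sum_le_sum_abs _ _).trans ?_
    rw [← nsmul_eq_mul]
    refine sum_le_card_nsmul _ _ _ fun i _ => (abs_sum_le_sum_abs _ _).trans ?_
    exact (sum_le_univ_sum_of_nonneg fun _ => abs_nonneg _).trans (hcol _)
  rw [h1]
  rw [abs_le] at *
  constructor <;> linarith

/-- An approximate form of the recursion (k+1) p_{k+1} = T p_k for the Taylor coefficients of
exp(T), with T the mean row sum. The error is measured by the coefficients of |C|, so cancellation
in C is harmless. -/
theorem permCoeff_succ {n : ℕ} {C : Fin n → Fin n → ℝ} {R : ℝ}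
    (hrow : ∀ i, ∑ j, |C i j| ≤ R) (hcol : ∀ j, ∑ i, |C i j| ≤ R) (k : ℕ) :
    |((n : ℝ) - k) * ((k + 1) * permCoeff C (k + 1)) - (∑ i, ∑ j, C i j) * permCoeff C k| ≤
      2 * R * k * permCoeff (fun i j => |C i j|) k := by
  have h1 : ((n : ℝ) - k) * ((k + 1) * permCoeff C (k + 1)) =
      ∑ τ : Equiv.Perm (Fin n), ∑ S ∈ powersetCard k univ,
        (∑ i ∈ Sᶜ, ∑ i' ∈ Sᶜ, C i (τ i')) * ∏ i ∈ S, C i (τ i) := by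
    unfold permCoeff
    rw [mul_sum univ _ ((k : ℝ) + 1)]
    simp_rw [sum_powersetCard_succ_mul]
    rw [sum_comm, sum_comm, sum_comm, mul_sum]
    rw [sum_comm (s := (univ : Finset (Equiv.Perm (Fin n))))]
    refine sum_congr rfl fun S hS => ?_
    rw [sum_comm, mul_sum]
    simp_rw [sum_mul]
    rw [sum_comm (s := (univ : Finset (Equiv.Perm (Fin n))))]
    refine sum_congr rfl fun i hi => ?_
    have := card_sub_mul_sum_perm_prod_insert C S (i := i) (by simpa using hi)
    rw [(mem_powersetCard.1 hS).2] at this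
    simp_rw [sum_mul] at this
    exact this
  rw [h1]
  unfold permCoeff
  rw [mul_sum, ← sum_sub_distrib, mul_sum]
  refine (abs_sum_le_sum_abs _ _).trans (sum_le_sum fun τ _ => ?_)
  rw [mul_sum, ← sum_sub_distrib, mul_sum]
  refine (abs_sum_le_sum_abs _ _).trans (sum_le_sum fun S hS => ?_)
  rw [← sub_mul, abs_mul, abs_prod]
  refine mul_le_mul_of_nonneg_right ?_ (prod_nonneg fun _ _ => abs_nonneg _)
  have := abs_sum_compl_sub_le hrow hcol S τ
  rwa [(mem_powersetCard.1 hS).2] at this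

theorem abs_total_div_le {n : ℕ} {C : Fin n → Fin n → ℝ} {R : ℝ} (hR : 0 ≤ R)
    (hrow : ∀ i, ∑ j, |C i j| ≤ R) : |(∑ i, ∑ j, C i j) / n| ≤ R := by
  rcases Nat.eq_zero_or_pos n with rfl | hn
  · simpa using hR
  rw [abs_div, Nat.abs_cast, div_le_iff₀ (by exact_mod_cast hn)]
  refine (abs_sum_le_sum_abs _ _).trans ?_
  calc _ ≤ ∑ i : Fin n, R := sum_le_sum fun i _ => (abs_sum_le_sum_abs _ _).trans (hrow i)
    _ = _ := by simp [mul_comm]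

/-- The index type and filter are arbitrary so that a may carry permutations besides the size;
convergence is then uniform in them. -/
theorem tendsto_permCoeff_sub {ι : Type*} {l : Filter ι} {N : ι → ℕ} (hN : Tendsto N l atTop)
    {C : ∀ a, Fin (N a) → Fin (N a) → ℝ} {R : ℝ} (hR : 0 ≤ R)
    (hrow : ∀ a i, ∑ j, |C a i j| ≤ R) (hcol : ∀ a j, ∑ i, |C a i j| ≤ R) (k : ℕ) :
    Tendsto (fun a => permCoeff (C a) k / (N a).factorial -
      ((∑ i, ∑ j, C a i j) / N a) ^ k / k.factorial) l (𝓝 0) := by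
  induction k with
  | zero =>
    refine tendsto_const_nhds.congr fun a => ?_
    have : ((N a).factorial : ℝ) ≠ 0 := by positivity
    simp [permCoeff, Fintype.card_perm, div_self this]
  | succ k ih =>
    have hNr : Tendsto (fun a => (N a : ℝ) - k) l atTop :=
      tendsto_atTop_add_const_right _ _ (tendsto_natCast_atTop_atTop.comp hN)
    set T : ι → ℝ := fun a => (∑ i, ∑ j, C a i j) / N a with hT
    set p : ℕ → ι → ℝ := fun k a => permCoeff (C a) k / (N a).factorial with hp
    -- Of the factor 3, two come from `permCoeff_succ` and one from replacing n by n - k in front of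
    -- T p_k.
    set M : ℝ := 3 * R * k * (R ^ k / k.factorial) with hM
    have hbound : ∀ᶠ a in l, ‖p (k + 1) a - T a ^ (k + 1) / (k + 1).factorial‖ ≤
        M / ((N a : ℝ) - k) + R * |p k a - T a ^ k / k.factorial| := by
      filter_upwards [hNr.eventually_gt_atTop 0] with a ha
      have hNpos : (0 : ℝ) < N a := by
        have : (0 : ℝ) ≤ k := by positivity
        linarith
      have hfac : (0 : ℝ) < (N a).factorial := by positivity
      have hTR : |T a| ≤ R := abs_total_div_le hR (hrow a)
      have hp_le : |p k a| ≤ R ^ k / k.factorial := by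
        simp only [hp, abs_div, Nat.abs_cast]
        exact (div_le_div_of_nonneg_right (abs_permCoeff_le _ _) hfac.le).trans
          (permCoeff_abs_div_factorial_le hR (hrow a) k)
      have h1 := permCoeff_succ (hrow a) (hcol a) k
      have h2 : |((N a : ℝ) - k) * ((k + 1) * p (k + 1) a) - N a * T a * p k a| ≤
          2 * R * k * (R ^ k / k.factorial) := by
        have e : ((N a : ℝ) - k) * ((k + 1) * p (k + 1) a) - N a * T a * p k a =
            (((N a : ℝ) - k) * ((k + 1) * permCoeff (C a) (k + 1)) -
              (∑ i, ∑ j, C a i j) * permCoeff (C a) k) / (N a).factorial := by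
          simp only [hp, hT]
          field_simp
        rw [e, abs_div, Nat.abs_cast]
        refine (div_le_div_of_nonneg_right h1 hfac.le).trans ?_
        rw [mul_div_assoc]
        exact mul_le_mul_of_nonneg_left (permCoeff_abs_div_factorial_le hR (hrow a) k) (by positivity)
      have h3 : |((N a : ℝ) - k) * ((k + 1) * p (k + 1) a - T a * p k a)| ≤ M := by
        have e : ((N a : ℝ) - k) * ((k + 1) * p (k + 1) a - T a * p k a) =
          (((N a : ℝ) - k) * ((k + 1) * p (k + 1) a) - N a * T a * p k a) + k * (T a * p k a) := by
          ring
        rw [e]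
        refine (abs_add_le _ _).trans ?_
        have : |k * (T a * p k a)| ≤ k * (R * (R ^ k / k.factorial)) := by
          rw [abs_mul, abs_mul, Nat.abs_cast]
          gcongr
        simp only [hM]
        linarith
      have h4 : |(k + 1) * p (k + 1) a - T a * p k a| ≤ M / ((N a : ℝ) - k) := by
        rw [le_div_iff₀ ha]
        rwa [abs_mul, abs_of_pos ha, mul_comm] at h3
      have h5 : |T a * (p k a - T a ^ k / k.factorial)| ≤ R * |p k a - T a ^ k / k.factorial| := by
        rw [abs_mul]
        gcongr
      have e : p (k + 1) a - T a ^ (k + 1) / (k + 1).factorial =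
          (((k + 1) * p (k + 1) a - T a * p k a) + T a * (p k a - T a ^ k / k.factorial)) /
            (k + 1) := by
        rw [Nat.factorial_succ]
        push_cast
        field_simp
        ring
      rw [e, Real.norm_eq_abs, abs_div, abs_of_pos (by positivity : (0 : ℝ) < k + 1)]
      refine (div_le_self (abs_nonneg _) (by linarith [(Nat.cast_nonneg k : (0 : ℝ) ≤ k)])).trans ?_
      exact (abs_add_le _ _).trans (add_le_add h4 h5)
    refine squeeze_zero_norm' hbound ?_
    have := (hNr.const_div_atTop M).add ((ih.abs).const_mul R)
    simpa using this

/-- The permanent of `1 + C`, divided by `n!`, is asymptotically `exp` of the mean row sum of `C`,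
uniformly over matrices `C` with bounded absolute row and column sums. -/
theorem tendsto_permAvg_prod_one_add_sub_exp {ι : Type*} {l : Filter ι} {N : ι → ℕ}
    (hN : Tendsto N l atTop) {C : ∀ a, Fin (N a) → Fin (N a) → ℝ} {R : ℝ} (hR : 0 ≤ R)
    (hrow : ∀ a i, ∑ j, |C a i j| ≤ R) (hcol : ∀ a j, ∑ i, |C a i j| ≤ R) :
    Tendsto (fun a => permAvg (fun τ => ∏ i, (1 + C a i (τ i))) -
      Real.exp ((∑ i, ∑ j, C a i j) / N a)) l (𝓝 0) := by
  have hsR : Summable fun k : ℕ => 2 * (R ^ k / k.factorial) :=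
    (Real.summable_pow_div_factorial R).mul_left 2
  have hb1 : ∀ a k, ‖permCoeff (C a) k / (N a).factorial‖ ≤ R ^ k / k.factorial := fun a k => by
    rw [norm_div, Real.norm_eq_abs, Real.norm_natCast]
    exact (div_le_div_of_nonneg_right (abs_permCoeff_le _ _) (by positivity)).trans
      (permCoeff_abs_div_factorial_le hR (hrow a) k)
  have hb2 : ∀ a k, ‖((∑ i, ∑ j, C a i j) / N a) ^ k / k.factorial‖ ≤ R ^ k / k.factorial :=
    fun a k => by
    rw [norm_div, norm_pow, Real.norm_eq_abs, Real.norm_natCast]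
    have := abs_total_div_le hR (hrow a)
    gcongr
  -- Dominated convergence for series: both families of coefficients are bounded by R^k / k!.
  have key : Tendsto (fun a => ∑' k, (permCoeff (C a) k / (N a).factorial -
      ((∑ i, ∑ j, C a i j) / N a) ^ k / k.factorial)) l (𝓝 (∑' _ : ℕ, (0 : ℝ))) := by
    refine tendsto_tsum_of_dominated_convergence hsR
      (tendsto_permCoeff_sub hN hR hrow hcol) (Eventually.of_forall fun a k => ?_)
    refine (norm_sub_le _ _).trans ?_
    linarith [hb1 a k, hb2 a k]
  rw [tsum_zero] at key
  refine key.congr fun a => ?_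
  have hs := Real.summable_pow_div_factorial R
  rw [Summable.tsum_sub (Summable.of_norm_bounded hs (hb1 a))
    (Summable.of_norm_bounded hs (hb2 a)), permAvg_prod_one_add, Real.exp_eq_exp_ℝ,
    NormedSpace.exp_eq_tsum_div]

end MMP

/-! ### Permutation averages weighted by overlaps. -/

namespace MMP

open Finset Topology

/-- `s ^ #{i | ρ i = σ i}`. -/
noncomputable def agree {n : ℕ} (s : ℝ) (ρ σ : Equiv.Perm (Fin n)) : ℝ :=
  ∏ i, if ρ i = σ i then s else 1

theorem agree_eq_pow {n : ℕ} (s : ℝ) (ρ σ : Equiv.Perm (Fin n)) :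
    agree s ρ σ = s ^ #{i | ρ i = σ i} := by
  rw [agree, prod_ite, prod_const, prod_const_one, mul_one]

theorem agree_nonneg {n : ℕ} {s : ℝ} (hs : 0 ≤ s) (ρ σ : Equiv.Perm (Fin n)) :
    0 ≤ agree s ρ σ := by
  rw [agree_eq_pow]
  positivity

theorem agree_mul {n : ℕ} (s t : ℝ) (ρ σ : Equiv.Perm (Fin n)) :
    agree s ρ σ * agree t ρ σ = agree (s * t) ρ σ := by
  simp only [agree_eq_pow, mul_pow]

theorem permAvg_mono {n : ℕ} {f g : Equiv.Perm (Fin n) → ℝ} (h : ∀ σ, f σ ≤ g σ) :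
    permAvg f ≤ permAvg g :=
  div_le_div_of_nonneg_right (sum_le_sum fun σ _ => h σ) (by positivity)

theorem permAvg_const {n : ℕ} (c : ℝ) : permAvg (fun _ : Equiv.Perm (Fin n) => c) = c := by
  have : (n.factorial : ℝ) ≠ 0 := by positivity
  simp [permAvg, Fintype.card_perm, this]

theorem permAvg_add {n : ℕ} (f g : Equiv.Perm (Fin n) → ℝ) :
    permAvg (fun σ => f σ + g σ) = permAvg f + permAvg g := by
  simp [permAvg, sum_add_distrib, add_div]

theorem permAvg_sub {n : ℕ} (f g : Equiv.Perm (Fin n) → ℝ) :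
    permAvg (fun σ => f σ - g σ) = permAvg f - permAvg g := by
  simp [permAvg, sum_sub_distrib, sub_div]

theorem permAvg_mul_left {n : ℕ} (c : ℝ) (f : Equiv.Perm (Fin n) → ℝ) :
    permAvg (fun σ => c * f σ) = c * permAvg f := by
  rw [permAvg, permAvg, ← mul_sum, mul_div_assoc]

theorem permAvg_mul_right {n : ℕ} (c : ℝ) (f : Equiv.Perm (Fin n) → ℝ) :
    permAvg (fun σ => f σ * c) = permAvg f * c := by
  simp_rw [mul_comm _ c, permAvg_mul_left]

theorem abs_permAvg_le {n : ℕ} (f : Equiv.Perm (Fin n) → ℝ) :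
    |permAvg f| ≤ permAvg fun σ => |f σ| := by
  unfold permAvg
  rw [abs_div, Nat.abs_cast]
  exact div_le_div_of_nonneg_right (abs_sum_le_sum_abs _ _) (by positivity)

/-- Convergence along `comap Sigma.fst atTop` means convergence as n → ∞ uniformly over all
permutations of `Fin n`. -/
theorem tendsto_permAvg_of_uniform {f : ∀ n, Equiv.Perm (Fin n) → ℝ} {L : ℝ}
    (h : Tendsto (fun p : Σ n, Equiv.Perm (Fin n) => f p.1 p.2) (comap Sigma.fst atTop) (𝓝 L)) :
    Tendsto (fun n => permAvg (f n)) atTop (𝓝 L) := by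
  rw [Metric.tendsto_atTop]
  intro ε hε
  have h1 := (Metric.tendsto_nhds.1 h) (ε / 2) (half_pos hε)
  rw [eventually_comap] at h1
  obtain ⟨n₀, hn₀⟩ := eventually_atTop.1 h1
  refine ⟨n₀, fun n hn => ?_⟩
  have h2 : |permAvg (fun σ => f n σ - L)| ≤ ε / 2 := by
    refine (abs_permAvg_le _).trans ?_
    rw [← permAvg_const (n := n) (ε / 2)]
    exact permAvg_mono fun σ => (hn₀ n hn ⟨n, σ⟩ rfl).le
  rw [permAvg_sub, permAvg_const] at h2
  rw [Real.dist_eq]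
  linarith

theorem sum_ite_perm_eq {n : ℕ} (ρ : Equiv.Perm (Fin n)) (j : Fin n) (B : ℝ) :
    ∑ i, (if ρ i = j then B else 0) = B := by
  simp_rw [← Equiv.eq_symm_apply]
  simp

/-- Here C is y - 1 times the permutation matrix of ρ, whose mean row sum is y - 1. The base y may
vary with the size, as the mixed moment with `edgeProd` requires. -/
theorem tendsto_permAvg_agree {ι : Type*} {l : Filter ι} {N : ι → ℕ} (hN : Tendsto N l atTop)
    (ρ : ∀ a, Equiv.Perm (Fin (N a))) {y : ℕ → ℝ} {y₀ : ℝ} (hy : Tendsto y atTop (𝓝 y₀)) :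
    Tendsto (fun a => permAvg (agree (y (N a)) (ρ a))) l (𝓝 (Real.exp (y₀ - 1))) := by
  have hy1 : Tendsto (fun n => y n - 1) atTop (𝓝 (y₀ - 1)) := hy.sub_const 1
  obtain ⟨R, hR⟩ := (Metric.isBounded_range_of_tendsto _ hy1).exists_norm_le
  have hR' : ∀ n, |y n - 1| ≤ R := fun n => hR _ ⟨n, rfl⟩
  have hR0 : 0 ≤ R := (abs_nonneg _).trans (hR' 0)
  have key := tendsto_permAvg_prod_one_add_sub_exp hN (R := R) hR0
    (C := fun a i j => if ρ a i = j then y (N a) - 1 else 0)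
    (fun a i => by
      simp only [apply_ite abs, abs_zero, sum_ite_eq, mem_univ, if_true]
      exact hR' _)
    (fun a j => by
      simp only [apply_ite abs, abs_zero, sum_ite_perm_eq]
      exact hR' _)
  have hexp : Tendsto (fun a => Real.exp ((∑ i, ∑ j, if ρ a i = j then y (N a) - 1 else 0) / N a))
      l (𝓝 (Real.exp (y₀ - 1))) := by
    refine (Real.continuous_exp.tendsto _).comp ((hy1.comp hN).congr' ?_)
    filter_upwards [hN.eventually_gt_atTop 0] with a ha
    have : (N a : ℝ) ≠ 0 := by exact_mod_cast ha.ne'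
    simp only [Function.comp_apply, sum_ite_eq, mem_univ, if_true, sum_const, card_univ,
      Fintype.card_fin, nsmul_eq_mul]
    rw [mul_div_cancel_left₀ _ this]
  have := key.add hexp
  rw [zero_add] at this
  refine this.congr fun a => ?_
  rw [sub_add_cancel]
  congr 1
  funext τ
  refine prod_congr rfl fun i _ => ?_
  split_ifs <;> ring

theorem abs_exp_sub_exp_le {x y R : ℝ} (hx : |x| ≤ R) (hy : |y| ≤ R) :
    |Real.exp x - Real.exp y| ≤ Real.exp R * |x - y| := by
  wlog h : y ≤ x generalizing x y
  · rw [abs_sub_comm, abs_sub_comm x]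
    exact this hy hx (le_of_not_ge h)
  rw [abs_of_nonneg (sub_nonneg.2 h), abs_of_nonneg (sub_nonneg.2 (Real.exp_le_exp.2 h))]
  have h1 : Real.exp x * (1 + (y - x)) ≤ Real.exp y := by
    have := mul_le_mul_of_nonneg_left (Real.add_one_le_exp (y - x)) (Real.exp_pos x).le
    rw [← Real.exp_add, add_sub_cancel] at this
    linarith
  have h2 : Real.exp x ≤ Real.exp R := Real.exp_le_exp.2 ((le_abs_self x).trans hx)
  nlinarith [sub_nonneg.2 h]

/-- Entries of the perturbation matrix supported on the edges of `ρ` and `σ`: `γ` on common edges,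
`α` on the other edges of `ρ`, `δ` on the other edges of `σ`. -/
noncomputable def twoPermMatrix {n : ℕ} (α γ δ : ℝ) (ρ σ : Equiv.Perm (Fin n)) (i j : Fin n) : ℝ :=
  if ρ i = j then (if σ i = j then γ else α) else (if σ i = j then δ else 0)

theorem abs_twoPermMatrix_le {n : ℕ} (α γ δ : ℝ) (ρ σ : Equiv.Perm (Fin n)) (i j : Fin n) :
    |twoPermMatrix α γ δ ρ σ i j| ≤ (if ρ i = j then |α| + |γ| + |δ| else 0) +
      (if σ i = j then |α| + |γ| + |δ| else 0) := by
  have hα := abs_nonneg α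
  have hγ := abs_nonneg γ
  have hδ := abs_nonneg δ
  unfold twoPermMatrix
  split_ifs <;> (try rw [abs_zero]) <;> linarith

theorem sum_twoPermMatrix_row {n : ℕ} (α γ δ : ℝ) (ρ σ : Equiv.Perm (Fin n)) (i : Fin n) :
    ∑ j, twoPermMatrix α γ δ ρ σ i j = α + δ + if ρ i = σ i then γ - α - δ else 0 := by
  have : ∀ j, twoPermMatrix α γ δ ρ σ i j = (if ρ i = j then α else 0) +
      (if σ i = j then δ else 0) +
      (if ρ i = j then (if ρ i = σ i then γ - α - δ else 0) else 0) := by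
    intro j
    unfold twoPermMatrix
    by_cases h1 : ρ i = j <;> by_cases h2 : σ i = j
    · simp [h1, h2]
    · have : ¬ j = σ i := fun h => h2 h.symm
      simp [h1, h2, this]
    · simp [h1, h2]
    · simp [h1, h2]
  simp_rw [this, sum_add_distrib]
  simp

/-- This crude bound lets the overlap count be absorbed into the weight, since `agree a * agree 2 =
agree (a * 2)` still has a bounded average. -/
theorem nat_le_agree_two {n : ℕ} (ρ σ : Equiv.Perm (Fin n)) :
    (#{i | ρ i = σ i} : ℝ) ≤ agree 2 ρ σ := by
  rw [agree_eq_pow]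
  exact_mod_cast (Nat.lt_two_pow_self).le

/-- If ρ and σ share k edges, the mean row sum is α + δ + k(γ - α - δ)/n. The correction is
negligible even under the weight a^k, so γ disappears from the limit. -/
theorem tendsto_permAvg_agree_mul_permAvg_twoPermMatrix (a α γ δ : ℝ) (ha : 0 ≤ a) :
    Tendsto (fun p : Σ n, Equiv.Perm (Fin n) => permAvg fun σ => agree a p.2 σ *
        permAvg fun τ => ∏ i, (1 + twoPermMatrix α γ δ p.2 σ i (τ i)))
      (comap Sigma.fst atTop) (𝓝 (Real.exp (a - 1) * Real.exp (α + δ))) := by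
  set B := |α| + |γ| + |δ| with hB
  have hα := abs_nonneg α
  have hγ := abs_nonneg γ
  have hδ := abs_nonneg δ
  set R := 2 * B with hR
  have hR0 : 0 ≤ R := by positivity
  set G : ∀ n, Equiv.Perm (Fin n) → Equiv.Perm (Fin n) → ℝ := fun n ρ σ =>
    permAvg fun τ => ∏ i, (1 + twoPermMatrix α γ δ ρ σ i (τ i)) with hG
  set T : ∀ n, Equiv.Perm (Fin n) → Equiv.Perm (Fin n) → ℝ := fun n ρ σ =>
    (∑ i, ∑ j, twoPermMatrix α γ δ ρ σ i j) / n with hT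
  have hrow : ∀ n (ρ σ : Equiv.Perm (Fin n)) i, ∑ j, |twoPermMatrix α γ δ ρ σ i j| ≤ R := by
    intro n ρ σ i
    refine (sum_le_sum fun j _ => abs_twoPermMatrix_le α γ δ ρ σ i j).trans ?_
    rw [sum_add_distrib]
    simp only [sum_ite_eq, mem_univ, if_true]
    linarith
  have hcol : ∀ n (ρ σ : Equiv.Perm (Fin n)) j, ∑ i, |twoPermMatrix α γ δ ρ σ i j| ≤ R := by
    intro n ρ σ j
    refine (sum_le_sum fun i _ => abs_twoPermMatrix_le α γ δ ρ σ i j).trans ?_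
    rw [sum_add_distrib, sum_ite_perm_eq, sum_ite_perm_eq]
    linarith
  -- Indexing by n together with the pair (ρ, σ) makes the estimate uniform in both permutations.
  have key := tendsto_permAvg_prod_one_add_sub_exp
    (l := comap (Sigma.fst : (Σ n, Equiv.Perm (Fin n) × Equiv.Perm (Fin n)) → ℕ) atTop)
    (N := Sigma.fst) tendsto_comap hR0
    (C := fun p => twoPermMatrix α γ δ p.2.1 p.2.2)
    (fun p i => hrow _ _ _ i) (fun p j => hcol _ _ _ j)
  have hTκ : ∀ n (ρ σ : Equiv.Perm (Fin n)), 0 < n →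
      |Real.exp (T n ρ σ) - Real.exp (α + δ)| ≤ Real.exp R * (2 * B) / n * agree 2 ρ σ := by
    intro n ρ σ hn
    have hn' : (0 : ℝ) < n := by exact_mod_cast hn
    have e : T n ρ σ - (α + δ) = #{i | ρ i = σ i} * (γ - α - δ) / n := by
      simp only [hT, sum_twoPermMatrix_row, sum_add_distrib, sum_const, card_univ, Fintype.card_fin,
        nsmul_eq_mul]
      rw [← sum_filter, sum_const, nsmul_eq_mul]
      field_simp
      ring
    have h1 : |α + δ| ≤ R := by
      have := abs_add_le α δ
      linarith
    refine (abs_exp_sub_exp_le (abs_total_div_le hR0 (hrow n ρ σ)) h1).trans ?_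
    have h2 : |γ - α - δ| ≤ 2 * B := by
      have h3 := abs_sub (γ - α) δ
      have h4 := abs_sub γ α
      linarith
    rw [e, abs_div, abs_mul, Nat.abs_cast, Nat.abs_cast, mul_div_assoc (Real.exp R),
      mul_assoc (Real.exp R)]
    refine mul_le_mul_of_nonneg_left ?_ (Real.exp_pos _).le
    rw [div_mul_eq_mul_div]
    refine div_le_div_of_nonneg_right ?_ hn'.le
    rw [mul_comm]
    exact mul_le_mul h2 (nat_le_agree_two ρ σ) (by positivity) (by positivity)
  have hN : Tendsto (Sigma.fst : (Σ n, Equiv.Perm (Fin n)) → ℕ) (comap Sigma.fst atTop) atTop :=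
    tendsto_comap
  have hA := tendsto_permAvg_agree hN (fun p => p.2) (y := fun _ => a) tendsto_const_nhds
  have hA2 := tendsto_permAvg_agree hN (fun p => p.2) (y := fun _ => a * 2) tendsto_const_nhds
  have hdiff : Tendsto (fun p : Σ n, Equiv.Perm (Fin n) =>
      permAvg (fun σ => agree a p.2 σ * (G p.1 p.2 σ - Real.exp (α + δ))))
      (comap Sigma.fst atTop) (𝓝 0) := by
    have hinv : Tendsto (fun p : Σ n, Equiv.Perm (Fin n) =>
        Real.exp R * (2 * B) / (p.1 : ℝ) * permAvg (agree (a * 2) p.2))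
        (comap Sigma.fst atTop) (𝓝 0) := by
      have h0 : Tendsto (fun p : Σ n, Equiv.Perm (Fin n) => Real.exp R * (2 * B) / (p.1 : ℝ))
          (comap Sigma.fst atTop) (𝓝 0) :=
        (tendsto_natCast_atTop_atTop.comp hN).const_div_atTop _
      simpa using h0.mul hA2
    rw [Metric.tendsto_nhds]
    intro ε hε
    set M := Real.exp (a - 1) + 1 with hM
    have hMpos : 0 < M := by positivity
    have h1 := (Metric.tendsto_nhds.1 key) (ε / (2 * M)) (by positivity)
    rw [eventually_comap] at h1
    have h2 := h1.and (eventually_gt_atTop 0)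
    filter_upwards [hN.eventually h2, hinv.eventually_lt_const (half_pos hε),
      hA.eventually_lt_const (lt_add_one _)] with p hp hp2 hp3
    obtain ⟨hp1, hp0⟩ := hp
    rw [dist_zero_right, Real.norm_eq_abs]
    refine (abs_permAvg_le _).trans_lt ?_
    calc _ ≤ permAvg (fun σ => agree a p.2 σ * (ε / (2 * M)) +
            Real.exp R * (2 * B) / p.1 * agree (a * 2) p.2 σ) := by
          refine permAvg_mono fun σ => ?_
          rw [abs_mul, abs_of_nonneg (agree_nonneg ha _ _), ← agree_mul a 2]
          have h3 : |G p.1 p.2 σ - Real.exp (T p.1 p.2 σ)| ≤ ε / (2 * M) := by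
            have := hp1 ⟨p.1, p.2, σ⟩ rfl
            rw [dist_zero_right] at this
            exact this.le
          have h4 := hTκ p.1 p.2 σ hp0
          have h5 : |G p.1 p.2 σ - Real.exp (α + δ)| ≤ ε / (2 * M) +
              Real.exp R * (2 * B) / p.1 * agree 2 p.2 σ :=
            (abs_sub_le _ _ _).trans (add_le_add h3 h4)
          refine (mul_le_mul_of_nonneg_left h5 (agree_nonneg ha _ _)).trans (le_of_eq ?_)
          ring
      _ < ε := by
          rw [permAvg_add, permAvg_mul_left, permAvg_mul_right]
          have : permAvg (agree a p.2) * (ε / (2 * M)) ≤ ε / 2 := by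
            refine (mul_le_mul_of_nonneg_right hp3.le (by positivity)).trans (le_of_eq ?_)
            rw [← hM]
            field_simp
          linarith
  have := hdiff.add (hA.mul_const (Real.exp (α + δ)))
  rw [zero_add] at this
  refine this.congr fun p => ?_
  rw [← permAvg_mul_right, ← permAvg_add]
  congr 1
  funext σ
  ring

end MMP

/-! ### Exact mixed moments of permutation weights and the edge product. -/

namespace MMP

open Finset Topology

/-- The product of the entries of `x` along the permutation `σ`. -/
noncomputable def permWeight {n : ℕ} (x : Edge n → ℝ) (σ : Equiv.Perm (Fin n)) : ℝ :=
  ∏ i, x (i, σ i)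

/-- The average permutation weight `perm x / n!`. -/
noncomputable def avgWeight {n : ℕ} (x : Edge n → ℝ) : ℝ :=
  permAvg (permWeight x)

/-- The average permutation weight tilted by `s` to the overlap with `ρ`. -/
noncomputable def tiltedAvgWeight {n : ℕ} (s : ℝ) (x : Edge n → ℝ) (ρ : Equiv.Perm (Fin n)) : ℝ :=
  permAvg fun τ => permWeight x τ * agree s ρ τ

/-- The product `∏ (1 + (x e - 1) / n)` over all edges. -/
noncomputable def edgeProd {n : ℕ} (x : Edge n → ℝ) : ℝ :=
  ∏ e, (1 + (x e - 1) / n)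

/-- Products along a permutation are rewritten over all n² edges, the form in which independence
factorises expectations. -/
theorem prod_edge_ite {n : ℕ} (σ : Equiv.Perm (Fin n)) (G : Edge n → ℝ) :
    ∏ e : Edge n, (if σ e.1 = e.2 then G e else 1) = ∏ i, G (i, σ i) := by
  rw [Fintype.prod_prod_type]
  simp

theorem permWeight_eq_prod_edge {n : ℕ} (x : Edge n → ℝ) (σ : Equiv.Perm (Fin n)) :
    permWeight x σ = ∏ e : Edge n, (if σ e.1 = e.2 then x e else 1) :=
  (prod_edge_ite σ x).symm

theorem agree_eq_prod_edge {n : ℕ} (s : ℝ) (ρ σ : Equiv.Perm (Fin n)) :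
    agree s ρ σ =
      ∏ e : Edge n, (if σ e.1 = e.2 then (if ρ e.1 = e.2 then s else 1) else 1) := by
  rw [prod_edge_ite σ fun e => if ρ e.1 = e.2 then s else 1]
  rfl

theorem pow_eq_prod_edge {n : ℕ} (b : ℝ) (ρ : Equiv.Perm (Fin n)) :
    b ^ n = ∏ e : Edge n, (if ρ e.1 = e.2 then b else 1) := by
  rw [prod_edge_ite ρ fun _ => b]
  simp

variable {Ω : Type*} [MeasurableSpace Ω]

/-- Independent nonnegative edge weights with moments `1`, `lam`, `m3` of orders 1, 2, 3. -/
structure NormalizedWeights {n : ℕ} (P : Measure Ω) (x : Edge n → Ω → ℝ) (lam m3 : ℝ) :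
    Prop where
  aemeasurable : ∀ e, AEMeasurable (x e) P
  indep : iIndepFun x P
  nonneg : ∀ e ω, 0 ≤ x e ω
  integrable_one : ∀ e, Integrable (x e) P
  integrable_two : ∀ e, Integrable (fun ω => x e ω ^ 2) P
  integrable_three : ∀ e, Integrable (fun ω => x e ω ^ 3) P
  integral_one : ∀ e, ∫ ω, x e ω ∂P = 1
  integral_two : ∀ e, ∫ ω, x e ω ^ 2 ∂P = lam
  integral_three : ∀ e, ∫ ω, x e ω ^ 3 ∂P = m3

namespace NormalizedWeights

variable {n : ℕ} {P : Measure Ω} {x : Edge n → Ω → ℝ} {lam m3 : ℝ}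

theorem integrable_prod (h : NormalizedWeights P x lam m3) {F : Edge n → ℝ → ℝ}
    (hF : ∀ e, Measurable (F e)) (hI : ∀ e, Integrable (fun ω => F e (x e ω)) P) :
    Integrable (fun ω => ∏ e, F e (x e ω)) P := by
  have := h.indep.isProbabilityMeasure
  have hpi := h.indep.map_fun_eq_pi_map h.aemeasurable
  have h1 : Integrable (fun y : Edge n → ℝ => ∏ e, F e (y e))
      (Measure.pi fun e => P.map (x e)) := by
    have : ∀ e, IsProbabilityMeasure (P.map (x e)) := fun e =>
      Measure.isProbabilityMeasure_map (h.aemeasurable e)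
    refine Integrable.fintype_prod (f := F) fun e => ?_
    rw [integrable_map_measure (hF e).aestronglyMeasurable (h.aemeasurable e)]
    exact hI e
  rw [← hpi] at h1
  exact h1.comp_aemeasurable (aemeasurable_pi_lambda _ h.aemeasurable)

theorem integral_prod (h : NormalizedWeights P x lam m3) {F : Edge n → ℝ → ℝ}
    (hF : ∀ e, Measurable (F e)) :
    ∫ ω, ∏ e, F e (x e ω) ∂P = ∏ e, ∫ ω, F e (x e ω) ∂P :=
  h.indep.integral_fun_prod_comp h.aemeasurable fun e => (hF e).aestronglyMeasurable

theorem integrable_cubic (h : NormalizedWeights P x lam m3) (e : Edge n) (a b c d : ℝ) :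
    Integrable (fun ω => a + b * x e ω + c * x e ω ^ 2 + d * x e ω ^ 3) P := by
  have := h.indep.isProbabilityMeasure
  exact (((integrable_const a).add ((h.integrable_one e).const_mul b)).add
    ((h.integrable_two e).const_mul c)).add ((h.integrable_three e).const_mul d)

theorem integral_cubic (h : NormalizedWeights P x lam m3) (e : Edge n) (a b c d : ℝ) :
    ∫ ω, a + b * x e ω + c * x e ω ^ 2 + d * x e ω ^ 3 ∂P = a + b + c * lam + d * m3 := by
  have := h.indep.isProbabilityMeasure
  have h0 := integrable_const (μ := P) a
  have h1 := (h.integrable_one e).const_mul b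
  have h2 := (h.integrable_two e).const_mul c
  have h3 := (h.integrable_three e).const_mul d
  have h01 : Integrable (fun ω => a + b * x e ω) P := h0.add h1
  have h012 : Integrable (fun ω => a + b * x e ω + c * x e ω ^ 2) P := h01.add h2
  rw [integral_add h012 h3, integral_add h01 h2, integral_add h0 h1,
    integral_const_mul, integral_const_mul, integral_const_mul, h.integral_one, h.integral_two,
    h.integral_three]
  simp

/-- All statistics below are products of edge polynomials of degree at most 3, so three moments
determine their expectations; v e is the contribution of edge e. -/
theorem prod_cubic (h : NormalizedWeights P x lam m3) {F : Edge n → ℝ → ℝ} {v : Edge n → ℝ}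
    (hF : ∀ e, ∃ a b c d, (∀ t, F e t = a + b * t + c * t ^ 2 + d * t ^ 3) ∧
      v e = a + b + c * lam + d * m3) :
    Integrable (fun ω => ∏ e, F e (x e ω)) P ∧ ∫ ω, ∏ e, F e (x e ω) ∂P = ∏ e, v e := by
  choose a b c d hF hv using hF
  have hF' : ∀ e, F e = fun t => a e + b e * t + c e * t ^ 2 + d e * t ^ 3 :=
    fun e => funext (hF e)
  have hm : ∀ e, Measurable (F e) := fun e => by rw [hF' e]; fun_prop
  refine ⟨h.integrable_prod hm fun e => ?_, ?_⟩
  · simp_rw [hF e]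
    exact h.integrable_cubic e _ _ _ _
  · rw [h.integral_prod hm]
    refine prod_congr rfl fun e _ => ?_
    simp_rw [hF e, hv e]
    exact h.integral_cubic e _ _ _ _

theorem one_le_lam (h : NormalizedWeights P x lam m3) (e : Edge n) : 1 ≤ lam := by
  have h1 : 0 ≤ ∫ ω, 1 + (-2) * x e ω + 1 * x e ω ^ 2 + 0 * x e ω ^ 3 ∂P :=
    integral_nonneg fun ω => by
      have := sq_nonneg (x e ω - 1)
      simp only [Pi.zero_apply]
      nlinarith
  rw [h.integral_cubic] at h1
  linarith

theorem permWeight_mul_permWeight (h : NormalizedWeights P x lam m3) (σ τ : Equiv.Perm (Fin n)) :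
    Integrable (fun ω => permWeight (x · ω) σ * permWeight (x · ω) τ) P ∧
      ∫ ω, permWeight (x · ω) σ * permWeight (x · ω) τ ∂P = agree lam σ τ := by
  have := h.prod_cubic
    (F := fun e t => (if σ e.1 = e.2 then t else 1) * (if τ e.1 = e.2 then t else 1))
    (v := fun e => if τ e.1 = e.2 then (if σ e.1 = e.2 then lam else 1) else 1)
    (fun e => by
      split_ifs
      · exact ⟨0, 0, 1, 0, fun t => by ring, by ring⟩
      · exact ⟨0, 1, 0, 0, fun t => by ring, by ring⟩
      · exact ⟨0, 1, 0, 0, fun t => by ring, by ring⟩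
      · exact ⟨1, 0, 0, 0, fun t => by ring, by ring⟩)
  simpa only [permWeight_eq_prod_edge, agree_eq_prod_edge, ← prod_mul_distrib] using this

/-- Only edges of σ matter: E[x(1 + (x-1)/n)] = 1 + (λ-1)/n, while elsewhere the factor has mean 1.
-/
theorem permWeight_mul_edgeProd (h : NormalizedWeights P x lam m3) (σ : Equiv.Perm (Fin n)) :
    Integrable (fun ω => permWeight (x · ω) σ * edgeProd (x · ω)) P ∧
      ∫ ω, permWeight (x · ω) σ * edgeProd (x · ω) ∂P = (1 + (lam - 1) / n) ^ n := by
  have := h.prod_cubic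
    (F := fun e t => (if σ e.1 = e.2 then t else 1) * (1 + (t - 1) / n))
    (v := fun e => if σ e.1 = e.2 then 1 + (lam - 1) / n else 1)
    (fun e => by
      split_ifs
      · exact ⟨0, 1 - 1 / n, 1 / n, 0, fun t => by ring, by ring⟩
      · exact ⟨1 - 1 / n, 1 / n, 0, 0, fun t => by ring, by ring⟩)
  simpa only [permWeight_eq_prod_edge, edgeProd, pow_eq_prod_edge _ σ, ← prod_mul_distrib]
    using this

theorem edgeProd_sq (h : NormalizedWeights P x lam m3) :
    Integrable (fun ω => edgeProd (x · ω) ^ 2) P ∧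
      ∫ ω, edgeProd (x · ω) ^ 2 ∂P = (1 + (lam - 1) / n ^ 2) ^ (n ^ 2) := by
  have := h.prod_cubic (F := fun e t => (1 + (t - 1) / n) ^ 2)
    (v := fun e => 1 + (lam - 1) / n ^ 2)
    (fun e => ⟨(1 - 1 / n) ^ 2, 2 * (1 - 1 / n) * (1 / n), (1 / n) ^ 2, 0,
      fun t => by ring, by ring⟩)
  have e : (1 + (lam - 1) / (n : ℝ) ^ 2) ^ (n ^ 2) =
      ∏ _e : Edge n, (1 + (lam - 1) / (n : ℝ) ^ 2) := by
    simp [sq]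
  simpa only [edgeProd, ← prod_pow, e] using this

/-- The factor of an edge off ρ is extracted from all n² edges, leaving a quotient on the n edges of
ρ. -/
theorem permWeight_mul_edgeProd_sq (h : NormalizedWeights P x lam m3) (hlam : 1 ≤ lam)
    (ρ : Equiv.Perm (Fin n)) :
    Integrable (fun ω => permWeight (x · ω) ρ * edgeProd (x · ω) ^ 2) P ∧
      ∫ ω, permWeight (x · ω) ρ * edgeProd (x · ω) ^ 2 ∂P =
        (1 + (lam - 1) / n ^ 2) ^ (n ^ 2) *
          ((1 + 2 * (lam - 1) / n + (m3 - 2 * lam + 1) / n ^ 2) / (1 + (lam - 1) / n ^ 2)) ^ n := by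
  have hd : 1 + (lam - 1) / (n : ℝ) ^ 2 ≠ 0 := by
    have : 0 ≤ (lam - 1) / (n : ℝ) ^ 2 := div_nonneg (by linarith) (by positivity)
    positivity
  have := h.prod_cubic (F := fun e t => (if ρ e.1 = e.2 then t else 1) * (1 + (t - 1) / n) ^ 2)
    (v := fun e => (1 + (lam - 1) / n ^ 2) * (if ρ e.1 = e.2 then
      ((1 + 2 * (lam - 1) / n + (m3 - 2 * lam + 1) / n ^ 2) / (1 + (lam - 1) / n ^ 2)) else 1))
    (fun e => by
      split_ifs
      · refine ⟨0, (1 - 1 / n) ^ 2, 2 * (1 - 1 / n) * (1 / n), (1 / n) ^ 2,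
          fun t => by ring, ?_⟩
        rw [mul_div_cancel₀ _ hd]
        ring
      · exact ⟨(1 - 1 / n) ^ 2, 2 * (1 - 1 / n) * (1 / n), (1 / n) ^ 2, 0,
          fun t => by ring, by ring⟩)
  have e : (1 + (lam - 1) / (n : ℝ) ^ 2) ^ (n ^ 2) =
      ∏ _e : Edge n, (1 + (lam - 1) / (n : ℝ) ^ 2) := by
    simp [sq]
  simpa only [permWeight_eq_prod_edge, edgeProd, ← prod_pow, e, pow_eq_prod_edge _ ρ,
    ← prod_mul_distrib] using this

/-- Each edge of ρ and each edge of τ is charged 1 + (λ-1)/n; a common edge is thus charged the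
square, which the base of `agree` divides out. -/
theorem permWeight_mul_permWeight_mul_edgeProd (h : NormalizedWeights P x lam m3) (hlam : 1 ≤ lam)
    (s : ℝ) (ρ τ : Equiv.Perm (Fin n)) :
    Integrable (fun ω => permWeight (x · ω) ρ * (permWeight (x · ω) τ * agree s ρ τ) *
        edgeProd (x · ω)) P ∧
      ∫ ω, permWeight (x · ω) ρ * (permWeight (x · ω) τ * agree s ρ τ) *
          edgeProd (x · ω) ∂P =
        (1 + (lam - 1) / n) ^ n * (1 + (lam - 1) / n) ^ n *
          agree (s * (lam + (m3 - lam) / n) / (1 + (lam - 1) / n) ^ 2) ρ τ := by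
  have hd : 1 + (lam - 1) / (n : ℝ) ≠ 0 := by
    have : 0 ≤ (lam - 1) / (n : ℝ) := div_nonneg (by linarith) (by positivity)
    positivity
  have := h.prod_cubic (F := fun e t => (if ρ e.1 = e.2 then t else 1) *
      ((if τ e.1 = e.2 then t else 1) *
        (if τ e.1 = e.2 then (if ρ e.1 = e.2 then s else 1) else 1)) * (1 + (t - 1) / n))
    (v := fun e => (if ρ e.1 = e.2 then 1 + (lam - 1) / n else 1) *
      (if τ e.1 = e.2 then 1 + (lam - 1) / n else 1) *
      (if τ e.1 = e.2 then (if ρ e.1 = e.2 then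
        s * (lam + (m3 - lam) / n) / (1 + (lam - 1) / n) ^ 2 else 1) else 1))
    (fun e => by
      split_ifs
      · refine ⟨0, 0, s * (1 - 1 / n), s * (1 / n), fun t => by ring, ?_⟩
        rw [← sq, mul_div_cancel₀ _ (pow_ne_zero 2 hd)]
        ring
      · exact ⟨0, 1 - 1 / n, 1 / n, 0, fun t => by ring, by ring⟩
      · exact ⟨0, 1 - 1 / n, 1 / n, 0, fun t => by ring, by ring⟩
      · exact ⟨1 - 1 / n, 1 / n, 0, 0, fun t => by ring, by ring⟩)
  rw [agree_eq_prod_edge (s * _ / _)]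
  nth_rewrite 1 [pow_eq_prod_edge _ ρ]
  rw [pow_eq_prod_edge _ τ]
  simpa only [permWeight_eq_prod_edge, edgeProd, agree_eq_prod_edge, ← prod_mul_distrib] using this

/-- The pair (ρ, σ) alone contributes `agree (s * lam) ρ σ`. Each entry 1 + `twoPermMatrix` is the
ratio of an edge's expectation with τ using it to that without: sλ on ρ only, λ on σ only, s m3/λ on
both. -/
theorem permWeight_triple (h : NormalizedWeights P x lam m3) (hlam : 1 ≤ lam)
    (s : ℝ) (ρ σ τ : Equiv.Perm (Fin n)) :
    Integrable (fun ω => permWeight (x · ω) ρ * (permWeight (x · ω) σ * agree s ρ σ) *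
        (permWeight (x · ω) τ * agree s ρ τ)) P ∧
      ∫ ω, permWeight (x · ω) ρ * (permWeight (x · ω) σ * agree s ρ σ) *
          (permWeight (x · ω) τ * agree s ρ τ) ∂P =
        agree (s * lam) ρ σ * ∏ i, (1 + twoPermMatrix (s * lam - 1) (s * m3 / lam - 1) (lam - 1)
          ρ σ i (τ i)) := by
  have hd : lam ≠ 0 := by positivity
  have := h.prod_cubic (F := fun e t => (if ρ e.1 = e.2 then t else 1) *
      ((if σ e.1 = e.2 then t else 1) *
        (if σ e.1 = e.2 then (if ρ e.1 = e.2 then s else 1) else 1)) *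
      ((if τ e.1 = e.2 then t else 1) *
        (if τ e.1 = e.2 then (if ρ e.1 = e.2 then s else 1) else 1)))
    (v := fun e => (if σ e.1 = e.2 then (if ρ e.1 = e.2 then s * lam else 1) else 1) *
      (if τ e.1 = e.2 then (1 + twoPermMatrix (s * lam - 1) (s * m3 / lam - 1) (lam - 1)
          ρ σ e.1 e.2) else 1))
    (fun e => by
      dsimp only [twoPermMatrix]
      split_ifs
      · refine ⟨0, 0, 0, s ^ 2, fun t => by ring, ?_⟩
        field_simp
        ring
      all_goals first
        | exact ⟨1, 0, 0, 0, fun t => by ring1, by ring1⟩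
        | exact ⟨0, 0, 1, 0, fun t => by ring1, by ring1⟩
        | exact ⟨0, 0, s, 0, fun t => by ring1, by ring1⟩
        | exact ⟨0, 1, 0, 0, fun t => by ring1, by ring1⟩)
  rw [← prod_edge_ite τ fun e => 1 + twoPermMatrix (s * lam - 1) (s * m3 / lam - 1) (lam - 1)
          ρ σ e.1 e.2]
  simpa only [permWeight_eq_prod_edge, agree_eq_prod_edge, ← prod_mul_distrib] using this

end NormalizedWeights

end MMP

/-! ### Asymptotics of the second-moment quantities. -/

namespace MMP

open Finset Topology

variable {Ω : Type*} [MeasurableSpace Ω]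

theorem integral_permAvg {n : ℕ} {P : Measure Ω} {f : Equiv.Perm (Fin n) → Ω → ℝ}
    {v : Equiv.Perm (Fin n) → ℝ} (h : ∀ σ, Integrable (f σ) P ∧ ∫ ω, f σ ω ∂P = v σ) :
    Integrable (fun ω => permAvg fun σ => f σ ω) P ∧
      ∫ ω, permAvg (fun σ => f σ ω) ∂P = permAvg v := by
  unfold permAvg
  refine ⟨(integrable_finsetSum _ fun σ _ => (h σ).1).div_const _, ?_⟩
  rw [integral_div, integral_finsetSum _ fun σ _ => (h σ).1]
  simp_rw [(h _).2]

theorem integral_quadratic {P : Measure Ω} {f g k : Ω → ℝ} {a b d : ℝ} (c : ℝ)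
    (hf : Integrable f P ∧ ∫ ω, f ω ∂P = a) (hg : Integrable g P ∧ ∫ ω, g ω ∂P = b)
    (hk : Integrable k P ∧ ∫ ω, k ω ∂P = d) :
    Integrable (fun ω => f ω - 2 * c * g ω + c ^ 2 * k ω) P ∧
      ∫ ω, f ω - 2 * c * g ω + c ^ 2 * k ω ∂P = a - 2 * c * b + c ^ 2 * d := by
  have h1 : Integrable (fun ω => f ω - 2 * c * g ω) P := hf.1.sub (hg.1.const_mul _)
  refine ⟨h1.add (hk.1.const_mul _), ?_⟩
  rw [integral_add h1 (hk.1.const_mul _), integral_sub hf.1 (hg.1.const_mul _),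
    integral_const_mul, integral_const_mul, hf.2, hg.2, hk.2]

/-- The mean, over `ρ` drawn proportionally to its weight, of the squared distance of the tilted
average weight to `c * edgeProd x` (up to normalisation). -/
noncomputable def tiltedDefect {n : ℕ} (s c : ℝ) (x : Edge n → ℝ) : ℝ :=
  permAvg fun ρ => permWeight x ρ * (tiltedAvgWeight s x ρ - c * edgeProd x) ^ 2

namespace NormalizedWeights

variable {n : ℕ} {P : Measure Ω} {x : Edge n → Ω → ℝ} {lam m3 : ℝ}

theorem sq_avgWeight_sub_edgeProd (h : NormalizedWeights P x lam m3) :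
    Integrable (fun ω => (avgWeight (x · ω) - edgeProd (x · ω)) ^ 2) P ∧
      ∫ ω, (avgWeight (x · ω) - edgeProd (x · ω)) ^ 2 ∂P =
        permAvg (fun σ : Equiv.Perm (Fin n) => permAvg (agree lam σ)) -
          2 * (1 + (lam - 1) / n) ^ n + (1 + (lam - 1) / n ^ 2) ^ (n ^ 2) := by
  have h1 := integral_permAvg fun σ => integral_permAvg fun τ => h.permWeight_mul_permWeight σ τ
  have h2 := integral_permAvg fun σ => h.permWeight_mul_edgeProd σ
  have key := integral_quadratic 1 h1 h2 h.edgeProd_sq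
  simp only [permAvg_mul_left, permAvg_mul_right, permAvg_const, one_pow, one_mul, mul_one] at key
  have e : ∀ ω, (avgWeight (x · ω) - edgeProd (x · ω)) ^ 2 =
      permAvg (permWeight (x · ω)) * permAvg (permWeight (x · ω)) -
        2 * (permAvg (permWeight (x · ω)) * edgeProd (x · ω)) + edgeProd (x · ω) ^ 2 := by
    intro ω
    unfold avgWeight
    ring
  simp_rw [e]
  exact key

theorem permWeight_mul_sq_tilted_sub (h : NormalizedWeights P x lam m3) (hlam : 1 ≤ lam)
    (s c : ℝ) (ρ : Equiv.Perm (Fin n)) :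
    Integrable (fun ω => permWeight (x · ω) ρ *
        (tiltedAvgWeight s (x · ω) ρ - c * edgeProd (x · ω)) ^ 2) P ∧
      ∫ ω, permWeight (x · ω) ρ *
          (tiltedAvgWeight s (x · ω) ρ - c * edgeProd (x · ω)) ^ 2 ∂P =
        (permAvg fun σ => agree (s * lam) ρ σ * permAvg fun τ =>
          ∏ i, (1 + twoPermMatrix (s * lam - 1) (s * m3 / lam - 1) (lam - 1) ρ σ i (τ i))) -
        2 * c * ((1 + (lam - 1) / n) ^ n * (1 + (lam - 1) / n) ^ n *
          permAvg (agree (s * (lam + (m3 - lam) / n) / (1 + (lam - 1) / n) ^ 2) ρ)) +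
        c ^ 2 * ((1 + (lam - 1) / n ^ 2) ^ (n ^ 2) *
          ((1 + 2 * (lam - 1) / n + (m3 - 2 * lam + 1) / n ^ 2) /
            (1 + (lam - 1) / n ^ 2)) ^ n) := by
  have h1 := integral_permAvg fun σ => integral_permAvg fun τ => h.permWeight_triple hlam s ρ σ τ
  have h2 := integral_permAvg fun τ => h.permWeight_mul_permWeight_mul_edgeProd hlam s ρ τ
  have key := integral_quadratic c h1 h2 (h.permWeight_mul_edgeProd_sq hlam ρ)
  simp only [permAvg_mul_left, permAvg_mul_right] at key
  have e : ∀ ω, permWeight (x · ω) ρ *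
      (tiltedAvgWeight s (x · ω) ρ - c * edgeProd (x · ω)) ^ 2 =
      permWeight (x · ω) ρ * (permAvg fun σ => permWeight (x · ω) σ * agree s ρ σ) *
        (permAvg fun σ => permWeight (x · ω) σ * agree s ρ σ) -
      2 * c * (permWeight (x · ω) ρ * (permAvg fun σ => permWeight (x · ω) σ * agree s ρ σ) *
        edgeProd (x · ω)) + c ^ 2 * (permWeight (x · ω) ρ * edgeProd (x · ω) ^ 2) := by
    intro ω
    unfold tiltedAvgWeight
    ring
  simp_rw [e]
  exact key

theorem integrable_tiltedDefect (h : NormalizedWeights P x lam m3) (hlam : 1 ≤ lam) (s c : ℝ) :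
    Integrable (fun ω => tiltedDefect s c (x · ω)) P :=
  (integral_permAvg fun ρ => h.permWeight_mul_sq_tilted_sub hlam s c ρ).1

/-- For u ≥ -1/2 one has 1/(1+u) ≤ 1 - u + 2u². With u = (x-1)/n and n ≥ 2, each edge contributes at
most 1 + 2(λ-1)/n², and there are n² edges. -/
theorem integral_inv_edgeProd_le (h : NormalizedWeights P x lam m3) (hn : 2 ≤ n) :
    Integrable (fun ω => (edgeProd (x · ω))⁻¹) P ∧
      ∫ ω, (edgeProd (x · ω))⁻¹ ∂P ≤ Real.exp (2 * (lam - 1)) := by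
  have := h.indep.isProbabilityMeasure
  have hn' : (2 : ℝ) ≤ n := by exact_mod_cast hn
  have hn0 : (0 : ℝ) < n := by linarith
  have ht : ∀ t : ℝ, 0 ≤ t → -(1 / 2) ≤ (t - 1) / n := by
    intro t ht
    rw [le_div_iff₀ hn0]
    linarith
  have hm : Measurable fun t : ℝ => (1 + (t - 1) / n)⁻¹ := by fun_prop
  have hle : ∀ t : ℝ, 0 ≤ t → (1 + (t - 1) / n)⁻¹ ≤
      1 - (t - 1) / n + 2 * ((t - 1) / n) ^ 2 := by
    intro t h0
    have h1 := ht t h0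
    set u := (t - 1) / (n : ℝ) with hu
    rw [inv_le_iff_one_le_mul₀ (by linarith)]
    nlinarith [mul_nonneg (sq_nonneg u) (by linarith : 0 ≤ 1 + 2 * u)]
  have hI : ∀ e, Integrable (fun ω => (1 + (x e ω - 1) / n)⁻¹) P := by
    intro e
    refine Integrable.of_bound (C := 2)
      (hm.comp_aemeasurable (h.aemeasurable e)).aestronglyMeasurable
      (Eventually.of_forall fun ω => ?_)
    have h1 := ht _ (h.nonneg e ω)
    rw [Real.norm_eq_abs, abs_of_nonneg (inv_nonneg.2 (by linarith)),
      inv_le_iff_one_le_mul₀ (by linarith)]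
    linarith
  have e : ∀ ω, (edgeProd (x · ω))⁻¹ = ∏ e, (1 + (x e ω - 1) / n)⁻¹ := fun ω => by
    rw [edgeProd, prod_inv_distrib]
  simp_rw [e]
  refine ⟨h.integrable_prod (F := fun _ t => (1 + (t - 1) / n)⁻¹) (fun _ => hm) hI, ?_⟩
  rw [h.integral_prod (F := fun _ t => (1 + (t - 1) / n)⁻¹) (fun _ => hm)]
  have hone : ∀ e, ∫ ω, (1 + (x e ω - 1) / n)⁻¹ ∂P ≤ Real.exp (2 * (lam - 1) / n ^ 2) := by
    intro e
    have h1 : ∫ ω, (1 + (x e ω - 1) / n)⁻¹ ∂P ≤ ∫ ω, (1 + 1 / n + 2 / n ^ 2) +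
        (-(1 / n) - 4 / n ^ 2) * x e ω + 2 / n ^ 2 * x e ω ^ 2 + 0 * x e ω ^ 3 ∂P := by
      refine integral_mono (hI e) (h.integrable_cubic e _ _ _ _) fun ω => ?_
      refine (hle _ (h.nonneg e ω)).trans (le_of_eq ?_)
      ring
    rw [h.integral_cubic] at h1
    refine h1.trans ((le_of_eq ?_).trans (Real.add_one_le_exp _))
    ring
  calc _ ≤ ∏ _e : Edge n, Real.exp (2 * (lam - 1) / n ^ 2) := by
        refine prod_le_prod (fun e _ => integral_nonneg fun ω => ?_) fun e _ => hone e
        have h1 := ht _ (h.nonneg e ω)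
        exact inv_nonneg.2 (by linarith)
    _ = _ := by
        rw [prod_const, card_univ, Fintype.card_prod, Fintype.card_fin, ← Real.exp_nat_mul]
        congr 1
        push_cast
        field_simp

end NormalizedWeights

theorem tendsto_one_add_div_sq_pow_exp (t : ℝ) :
    Tendsto (fun n : ℕ => (1 + t / (n : ℝ) ^ 2) ^ (n ^ 2)) atTop (𝓝 (Real.exp t)) := by
  have := (Real.tendsto_one_add_div_pow_exp t).comp
    (tendsto_pow_atTop (α := ℕ) (n := 2) two_ne_zero)
  refine this.congr fun n => ?_
  simp

theorem tendsto_div_nat (t : ℝ) : Tendsto (fun n : ℕ => t / (n : ℝ)) atTop (𝓝 0) :=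
  tendsto_natCast_atTop_atTop.const_div_atTop t

theorem tendsto_div_nat_sq (t : ℝ) : Tendsto (fun n : ℕ => t / (n : ℝ) ^ 2) atTop (𝓝 0) :=
  ((tendsto_pow_atTop two_ne_zero).comp tendsto_natCast_atTop_atTop).const_div_atTop t

theorem tendsto_ratio_pow_exp (lam m3 : ℝ) :
    Tendsto (fun n : ℕ => ((1 + 2 * (lam - 1) / n + (m3 - 2 * lam + 1) / (n : ℝ) ^ 2) /
      (1 + (lam - 1) / (n : ℝ) ^ 2)) ^ n) atTop (𝓝 (Real.exp (2 * (lam - 1)))) := by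
  have hd : Tendsto (fun n : ℕ => 1 + (lam - 1) / (n : ℝ) ^ 2) atTop (𝓝 1) := by
    simpa using (tendsto_div_nat_sq (lam - 1)).const_add 1
  have hg : Tendsto (fun n : ℕ => (n : ℝ) *
      ((1 + 2 * (lam - 1) / n + (m3 - 2 * lam + 1) / (n : ℝ) ^ 2) /
      (1 + (lam - 1) / (n : ℝ) ^ 2) - 1)) atTop (𝓝 (2 * (lam - 1))) := by
    have h1 : Tendsto (fun n : ℕ => (2 * (lam - 1) + (m3 - 3 * lam + 2) / n) /
        (1 + (lam - 1) / (n : ℝ) ^ 2)) atTop (𝓝 ((2 * (lam - 1) + 0) / 1)) :=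
      ((tendsto_div_nat (m3 - 3 * lam + 2)).const_add (2 * (lam - 1))).div hd one_ne_zero
    rw [add_zero, div_one] at h1
    refine h1.congr' ?_
    filter_upwards [eventually_gt_atTop 0, hd.eventually_ne one_ne_zero] with n hn hne
    have hn' : (n : ℝ) ≠ 0 := by exact_mod_cast hn.ne'
    rw [div_sub_one hne, ← mul_div_assoc]
    congr 1
    field_simp
    ring
  refine (Real.tendsto_one_add_pow_exp_of_tendsto hg).congr fun n => ?_
  rw [add_sub_cancel]

section Array

variable {P : Measure Ω} {x : ∀ n, Edge n → Ω → ℝ} {lam m3 : ℝ}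

theorem tendsto_integral_sq_avgWeight_sub_edgeProd
    (h : ∀ n, NormalizedWeights P (x n) lam m3) :
    Tendsto (fun n => ∫ ω, (avgWeight (x n · ω) - edgeProd (x n · ω)) ^ 2 ∂P) atTop (𝓝 0) := by
  refine Tendsto.congr (fun n => (h n).sq_avgWeight_sub_edgeProd.2.symm) ?_
  have hN : Tendsto (Sigma.fst : (Σ n, Equiv.Perm (Fin n)) → ℕ) (comap Sigma.fst atTop) atTop :=
    tendsto_comap
  have h1 : Tendsto (fun n : ℕ => permAvg fun σ : Equiv.Perm (Fin n) => permAvg (agree lam σ))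
      atTop (𝓝 (Real.exp (lam - 1))) :=
    tendsto_permAvg_of_uniform (f := fun n σ => permAvg (agree lam σ))
      (tendsto_permAvg_agree hN (fun p => p.2) (y := fun _ => lam) tendsto_const_nhds)
  have h2 := (Real.tendsto_one_add_div_pow_exp (lam - 1)).const_mul 2
  have h3 := tendsto_one_add_div_sq_pow_exp (lam - 1)
  have := (h1.sub h2).add h3
  rwa [show Real.exp (lam - 1) - 2 * Real.exp (lam - 1) + Real.exp (lam - 1) = 0 by ring] at this

theorem tendsto_integral_tiltedDefect (h : ∀ n, NormalizedWeights P (x n) lam m3)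
    (hlam : 1 ≤ lam) {s : ℝ} (hs : 0 ≤ s) :
    Tendsto (fun n => ∫ ω, tiltedDefect s (Real.exp (lam * (s - 1))) (x n · ω) ∂P)
      atTop (𝓝 0) := by
  set c := Real.exp (lam * (s - 1)) with hc
  unfold tiltedDefect
  simp_rw [fun n => (integral_permAvg fun ρ =>
    (h n).permWeight_mul_sq_tilted_sub hlam s c ρ).2]
  apply tendsto_permAvg_of_uniform
  have hN : Tendsto (Sigma.fst : (Σ n, Equiv.Perm (Fin n)) → ℕ) (comap Sigma.fst atTop) atTop :=
    tendsto_comap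
  have hA := tendsto_permAvg_agree_mul_permAvg_twoPermMatrix (s * lam) (s * lam - 1)
    (s * m3 / lam - 1) (lam - 1) (by positivity)
  have hb := (Real.tendsto_one_add_div_pow_exp (lam - 1)).comp hN
  have hy : Tendsto (fun n : ℕ => s * (lam + (m3 - lam) / n) / (1 + (lam - 1) / n) ^ 2) atTop
      (𝓝 (s * (lam + 0) / (1 + 0) ^ 2)) :=
    (((tendsto_div_nat (m3 - lam)).const_add lam).const_mul s).div
      (((tendsto_div_nat (lam - 1)).const_add 1).pow 2) (by simp)
  rw [add_zero, add_zero, one_pow, div_one] at hy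
  have hB := tendsto_permAvg_agree hN (fun p => p.2) hy
  have hD := ((tendsto_one_add_div_sq_pow_exp (lam - 1)).mul
    (tendsto_ratio_pow_exp lam m3)).comp hN
  have key := (hA.sub (((hb.mul hb).mul hB).const_mul (2 * c))).add (hD.const_mul (c ^ 2))
  -- The value c = e^{λ(s-1)} makes all three exponents equal to 2sλ + λ - 3, so the limiting square
  -- vanishes.
  have e : Real.exp (s * lam - 1) * Real.exp (s * lam - 1 + (lam - 1)) -
      2 * c * (Real.exp (lam - 1) * Real.exp (lam - 1) * Real.exp (s * lam - 1)) +
      c ^ 2 * (Real.exp (lam - 1) * Real.exp (2 * (lam - 1))) = 0 := by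
    have e1 : c * (Real.exp (lam - 1) * Real.exp (lam - 1) * Real.exp (s * lam - 1)) =
        Real.exp (2 * s * lam + lam - 3) := by
      simp only [hc, ← Real.exp_add]
      ring_nf
    have e2 : c ^ 2 * (Real.exp (lam - 1) * Real.exp (2 * (lam - 1))) =
        Real.exp (2 * s * lam + lam - 3) := by
      simp only [hc, ← Real.exp_add, sq]
      ring_nf
    have e3 : Real.exp (s * lam - 1) * Real.exp (s * lam - 1 + (lam - 1)) =
        Real.exp (2 * s * lam + lam - 3) := by
      simp only [← Real.exp_add]
      ring_nf
    rw [mul_assoc 2 c, e1, e2, e3]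
    ring
  rw [e] at key
  exact key

end Array

end MMP

/-! ### Convergence in probability of the overlap generating function. -/

namespace MMP

open Finset Topology

variable {Ω : Type*} [MeasurableSpace Ω]

theorem sq_permAvg_mul_le {n : ℕ} {w : Equiv.Perm (Fin n) → ℝ} (hw : ∀ σ, 0 ≤ w σ)
    (g : Equiv.Perm (Fin n) → ℝ) :
    permAvg (fun σ => w σ * g σ) ^ 2 ≤ permAvg w * permAvg fun σ => w σ * g σ ^ 2 := by
  unfold permAvg
  rw [div_pow, div_mul_div_comm, ← sq]
  refine div_le_div_of_nonneg_right ?_ (by positivity)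
  exact sum_sq_le_sum_mul_sum_of_sq_le_mul _ (fun σ _ => hw σ)
    (fun σ _ => mul_nonneg (hw σ) (sq_nonneg _)) fun σ _ => le_of_eq (by ring)

theorem permAvg_nonneg {n : ℕ} {f : Equiv.Perm (Fin n) → ℝ} (h : ∀ σ, 0 ≤ f σ) :
    0 ≤ permAvg f :=
  div_nonneg (sum_nonneg fun σ _ => h σ) (by positivity)

theorem permWeight_nonneg {n : ℕ} {x : Edge n → ℝ} (hx : ∀ e, 0 ≤ x e) (σ : Equiv.Perm (Fin n)) :
    0 ≤ permWeight x σ :=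
  prod_nonneg fun _ _ => hx _

theorem tiltedDefect_nonneg {n : ℕ} {x : Edge n → ℝ} (hx : ∀ e, 0 ≤ x e) (s c : ℝ) :
    0 ≤ tiltedDefect s c x :=
  permAvg_nonneg fun σ => mul_nonneg (permWeight_nonneg hx σ) (sq_nonneg _)

/-- The mean of `f` of the overlap of two permutations drawn independently proportionally to their
weights. -/
noncomputable def overlapMean {n : ℕ} (f : ℕ → ℝ) (x : Edge n → ℝ) : ℝ :=
  permAvg (fun ρ => permAvg fun τ => permWeight x ρ * permWeight x τ * f #{i | ρ i = τ i}) /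
    avgWeight x ^ 2

theorem overlapMean_pow {n : ℕ} (s : ℝ) (x : Edge n → ℝ) :
    overlapMean (fun k => s ^ k) x =
      permAvg (fun ρ => permWeight x ρ * tiltedAvgWeight s x ρ) / avgWeight x ^ 2 := by
  simp_rw [overlapMean, tiltedAvgWeight, ← permAvg_mul_left, mul_assoc, agree_eq_pow]

/-- Deterministic core: with U the numerator, U - cZ² = (U - cQZ) + cZ(Q - Z). Cauchy-Schwarz bounds
the first term through `tiltedDefect`, closeness of Z and Q the second, and Z ≥ z permits the
division by Z². -/
theorem abs_overlapMean_pow_sub_lt {n : ℕ} {x : Edge n → ℝ} (hx : ∀ e, 0 ≤ x e) {s c z ε : ℝ}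
    (hc : 0 < c) (hz : 0 < z) (hε : 0 < ε) (hQ : 2 * z ≤ edgeProd x)
    (hZQ : |avgWeight x - edgeProd x| < min z (ε * z / (2 * c)))
    (hH : tiltedDefect s c x < ε ^ 2 * z ^ 3 / 4) :
    |overlapMean (fun k => s ^ k) x - c| < ε := by
  set Z := avgWeight x with hZ
  set Q := edgeProd x with hQ'
  set U := permAvg (fun ρ => permWeight x ρ * tiltedAvgWeight s x ρ) with hU
  obtain ⟨h1, h2⟩ := lt_min_iff.1 hZQ
  have hzZ : z ≤ Z := by
    have := (abs_lt.1 h1).1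
    linarith
  have hZpos : 0 < Z := hz.trans_le hzZ
  have hUc : U - c * Q * Z = permAvg fun ρ => permWeight x ρ * (tiltedAvgWeight s x ρ - c * Q) := by
    simp_rw [mul_sub]
    rw [permAvg_sub, permAvg_mul_right, hU, hZ, avgWeight]
    ring
  have hsq : (U - c * Q * Z) ^ 2 ≤ Z * tiltedDefect s c x := by
    rw [hUc]
    exact sq_permAvg_mul_le (permWeight_nonneg hx) _
  have hz3 : z ^ 3 ≤ Z ^ 3 := by gcongr
  have h3 : |U - c * Q * Z| ≤ ε * Z ^ 2 / 2 := by
    refine abs_le_of_sq_le_sq (hsq.trans ?_) (by positivity)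
    calc Z * tiltedDefect s c x ≤ Z * (ε ^ 2 * z ^ 3 / 4) := by gcongr
      _ ≤ Z * (ε ^ 2 * Z ^ 3 / 4) := by gcongr
      _ = _ := by ring
  have h4 : |c * Z * (Q - Z)| < ε * Z ^ 2 / 2 := by
    rw [abs_mul, abs_of_pos (by positivity : 0 < c * Z), abs_sub_comm]
    calc c * Z * |Z - Q| < c * Z * (ε * z / (2 * c)) := by gcongr
      _ = ε * Z * z / 2 := by field_simp
      _ ≤ ε * Z * Z / 2 := by gcongr
      _ = _ := by ring
  rw [overlapMean_pow, div_sub' (by positivity), abs_div, abs_of_pos (by positivity : 0 < Z ^ 2),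
    div_lt_iff₀ (by positivity)]
  have e : U - Z ^ 2 * c = (U - c * Q * Z) + c * Z * (Q - Z) := by ring
  rw [e]
  refine (abs_add_le _ _).trans_lt ?_
  linarith

theorem tendsto_measureReal_ge_of_integral {P : Measure Ω} {f : ℕ → Ω → ℝ}
    (h0 : ∀ n ω, 0 ≤ f n ω) (hi : ∀ n, Integrable (f n) P)
    (ht : Tendsto (fun n => ∫ ω, f n ω ∂P) atTop (𝓝 0)) {δ : ℝ} (hδ : 0 < δ) :
    Tendsto (fun n => P.real {ω | δ ≤ f n ω}) atTop (𝓝 0) := by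
  have h1 : Tendsto (fun n => (∫ ω, f n ω ∂P) / δ) atTop (𝓝 0) := by
    simpa using ht.div_const δ
  refine squeeze_zero (fun n => measureReal_nonneg) (fun n => ?_) h1
  rw [le_div_iff₀ hδ, mul_comm]
  exact mul_meas_ge_le_integral_of_nonneg (Eventually.of_forall (h0 n)) (hi n) δ

theorem NormalizedWeights.edgeProd_pos {n : ℕ} {P : Measure Ω} {x : Edge n → Ω → ℝ} {lam m3 : ℝ}
    (h : NormalizedWeights P x lam m3) (hn : 2 ≤ n) (ω : Ω) : 0 < edgeProd (x · ω) := by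
  have hn' : (2 : ℝ) ≤ n := by exact_mod_cast hn
  refine prod_pos fun e _ => ?_
  have : -1 < (x e ω - 1) / n := by
    rw [lt_div_iff₀ (by linarith)]
    linarith [h.nonneg e ω]
  linarith

section Array

variable {P : Measure Ω} [IsProbabilityMeasure P] {x : ∀ n, Edge n → Ω → ℝ} {lam m3 : ℝ}

theorem tendstoInMeasure_overlapMean_pow (h : ∀ n, NormalizedWeights P (x n) lam m3)
    {s : ℝ} (hs : 0 ≤ s) :
    TendstoInMeasure P (fun n ω => overlapMean (fun k => s ^ k) (x n · ω)) atTop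
      (fun _ => Real.exp (lam * (s - 1))) := by
  have hlam : 1 ≤ lam := (h 1).one_le_lam (0, 0)
  set c := Real.exp (lam * (s - 1)) with hc
  have hcpos : 0 < c := Real.exp_pos _
  rw [tendstoInMeasure_iff_measureReal_norm]
  intro ε hε
  rw [Metric.tendsto_atTop]
  intro θ hθ
  set M := Real.exp (2 * (lam - 1)) with hM
  have hMpos : 0 < M := Real.exp_pos _
  -- Chosen so that Markov's inequality for 1/Q gives a probability at most 2zM = θ/4 to the event
  -- that Q is below about 2z.
  set z := θ / (4 * M) / 2 with hz
  have hzpos : 0 < z := by positivity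
  set δ := min z (ε * z / (2 * c)) with hδ
  have hδpos : 0 < δ := lt_min hzpos (by positivity)
  have hZQ := tendsto_measureReal_ge_of_integral (fun n ω => sq_nonneg _)
    (fun n => (h n).sq_avgWeight_sub_edgeProd.1) (tendsto_integral_sq_avgWeight_sub_edgeProd h)
    (pow_pos hδpos 2)
  have hH := tendsto_measureReal_ge_of_integral
    (fun n ω => tiltedDefect_nonneg (fun e => (h n).nonneg e ω) s c)
    (fun n => (h n).integrable_tiltedDefect hlam s c) (tendsto_integral_tiltedDefect h hlam hs)
    (by positivity : 0 < ε ^ 2 * z ^ 3 / 4)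
  have hev := ((hZQ.eventually_lt_const (by positivity : 0 < θ / 4)).and
    (hH.eventually_lt_const (by positivity : 0 < θ / 4))).and (eventually_ge_atTop 2)
  obtain ⟨n₀, hn₀⟩ := eventually_atTop.1 hev
  refine ⟨n₀, fun n hn => ?_⟩
  obtain ⟨⟨h1, h2⟩, h3⟩ := hn₀ n hn
  rw [dist_zero_right, Real.norm_of_nonneg measureReal_nonneg]
  have hQ : P.real {ω | (2 * z)⁻¹ ≤ (edgeProd (x n · ω))⁻¹} ≤ θ / 4 := by
    obtain ⟨hi, hle⟩ := (h n).integral_inv_edgeProd_le h3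
    have := mul_meas_ge_le_integral_of_nonneg (Eventually.of_forall fun ω =>
      inv_nonneg.2 ((h n).edgeProd_pos h3 ω).le) hi (2 * z)⁻¹
    have h4 := this.trans hle
    rw [inv_mul_le_iff₀ (by positivity)] at h4
    refine h4.trans (le_of_eq ?_)
    rw [← hM, hz]
    field_simp
  have hsub : {ω | ε ≤ ‖overlapMean (fun k => s ^ k) (x n · ω) - c‖} ⊆
      {ω | (2 * z)⁻¹ ≤ (edgeProd (x n · ω))⁻¹} ∪
      ({ω | δ ^ 2 ≤ (avgWeight (x n · ω) - edgeProd (x n · ω)) ^ 2} ∪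
      {ω | ε ^ 2 * z ^ 3 / 4 ≤ tiltedDefect s c (x n · ω)}) := by
    intro ω hω
    by_contra hcon
    simp only [Set.mem_union, Set.mem_ofPred_eq, not_or, not_le] at hcon hω
    obtain ⟨h5, h6, h7⟩ := hcon
    have h8 : 2 * z ≤ edgeProd (x n · ω) :=
      ((inv_lt_inv₀ ((h n).edgeProd_pos h3 ω) (by positivity)).1 h5).le
    exact absurd (abs_overlapMean_pow_sub_lt (fun e => (h n).nonneg e ω) hcpos hzpos hε h8
      (abs_lt_of_sq_lt_sq h6 hδpos.le) h7) (not_lt.2 hω)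
  calc _ ≤ _ := measureReal_mono hsub
    _ ≤ _ := measureReal_union_le _ _
    _ ≤ _ := add_le_add_right (measureReal_union_le _ _) _
    _ < θ := by linarith

end Array

/-! ### From generating functions to bounded test functions. -/

theorem integral_pow_poissonMeasure (r : ℝ≥0) (s : ℝ) :
    ∫ k, s ^ k ∂(poissonMeasure r) = Real.exp (r * (s - 1)) := by
  rw [integral_poissonMeasure]
  have : ∀ k : ℕ, (Real.exp (-r) * r ^ k / k.factorial) • s ^ k =
      Real.exp (-r) * ((r * s) ^ k / k.factorial) := fun k => by
    rw [smul_eq_mul, mul_pow]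
    ring
  simp_rw [this]
  rw [tsum_mul_left, ← congrFun (NormedSpace.exp_eq_tsum_div (𝔸 := ℝ)) (r * s),
    ← Real.exp_eq_exp_ℝ, ← Real.exp_add]
  ring_nf

theorem overlapMean_add {n : ℕ} (f g : ℕ → ℝ) (x : Edge n → ℝ) :
    overlapMean (fun k => f k + g k) x = overlapMean f x + overlapMean g x := by
  simp_rw [overlapMean, mul_add, permAvg_add, add_div]

theorem overlapMean_const_mul {n : ℕ} (c : ℝ) (f : ℕ → ℝ) (x : Edge n → ℝ) :
    overlapMean (fun k => c * f k) x = c * overlapMean f x := by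
  simp_rw [overlapMean, mul_left_comm _ c, permAvg_mul_left, mul_div_assoc]

theorem overlapMean_mono {n : ℕ} {f g : ℕ → ℝ} (hfg : ∀ k, f k ≤ g k) {x : Edge n → ℝ}
    (hx : ∀ e, 0 ≤ x e) : overlapMean f x ≤ overlapMean g x := by
  refine div_le_div_of_nonneg_right ?_ (sq_nonneg _)
  exact permAvg_mono fun ρ => permAvg_mono fun τ => mul_le_mul_of_nonneg_left (hfg _)
    (mul_nonneg (permWeight_nonneg hx ρ) (permWeight_nonneg hx τ))

theorem abs_overlapMean_sub_le {n : ℕ} {f g k : ℕ → ℝ} (hfg : ∀ m, |f m - g m| ≤ k m)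
    {x : Edge n → ℝ} (hx : ∀ e, 0 ≤ x e) :
    |overlapMean f x - overlapMean g x| ≤ overlapMean k x := by
  rw [abs_sub_le_iff, sub_le_iff_le_add, sub_le_iff_le_add, ← overlapMean_add, ← overlapMean_add]
  refine ⟨overlapMean_mono (fun m => ?_) hx, overlapMean_mono (fun m => ?_) hx⟩
  · have := (abs_sub_le_iff.1 (hfg m)).1
    linarith
  · have := (abs_sub_le_iff.1 (hfg m)).2
    linarith

/-- The test function `f` is bounded and its mean under the overlap law converges in probability to
its mean under the Poisson law of rate `r`. -/
def OverlapConverges (P : Measure Ω) (x : ∀ n, Edge n → Ω → ℝ) (r : ℝ≥0) (f : ℕ → ℝ) : Prop :=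
  (∃ B, ∀ k, |f k| ≤ B) ∧ TendstoInMeasure P (fun n ω => overlapMean f (x n · ω)) atTop
    (fun _ => ∫ k, f k ∂(poissonMeasure r))

theorem integrable_poissonMeasure_of_bounded {r : ℝ≥0} {f : ℕ → ℝ} (hf : ∃ B, ∀ k, |f k| ≤ B) :
    Integrable f (poissonMeasure r) := by
  obtain ⟨B, hB⟩ := hf
  exact Integrable.of_bound (by fun_prop) B (Eventually.of_forall hB)

namespace OverlapConverges

variable {P : Measure Ω} [IsProbabilityMeasure P] {x : ∀ n, Edge n → Ω → ℝ} {r : ℝ≥0}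

theorem add {f g : ℕ → ℝ} (hf : OverlapConverges P x r f) (hg : OverlapConverges P x r g) :
    OverlapConverges P x r (fun k => f k + g k) := by
  obtain ⟨⟨A, hA⟩, hft⟩ := hf
  obtain ⟨⟨B, hB⟩, hgt⟩ := hg
  refine ⟨⟨A + B, fun k => (abs_add_le _ _).trans (add_le_add (hA k) (hB k))⟩, ?_⟩
  rw [integral_add (integrable_poissonMeasure_of_bounded ⟨A, hA⟩)
    (integrable_poissonMeasure_of_bounded ⟨B, hB⟩)]
  rw [tendstoInMeasure_iff_measureReal_norm] at hft hgt ⊢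
  intro ε hε
  have := (hft (ε / 2) (half_pos hε)).add (hgt (ε / 2) (half_pos hε))
  rw [add_zero] at this
  refine squeeze_zero (fun n => measureReal_nonneg) (fun n => ?_) this
  refine (measureReal_mono ?_).trans (measureReal_union_le _ _)
  intro ω hω
  by_contra hcon
  simp only [Set.mem_union, Set.mem_ofPred_eq, not_or, not_le, overlapMean_add] at hcon hω
  rw [add_sub_add_comm] at hω
  have := norm_add_le (overlapMean f (x n · ω) - ∫ k, f k ∂(poissonMeasure r))
    (overlapMean g (x n · ω) - ∫ k, g k ∂(poissonMeasure r))
  linarith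

theorem const_mul {f : ℕ → ℝ} (c : ℝ) (hf : OverlapConverges P x r f) :
    OverlapConverges P x r (fun k => c * f k) := by
  obtain ⟨⟨A, hA⟩, hft⟩ := hf
  refine ⟨⟨|c| * A, fun k => by
    rw [abs_mul]; exact mul_le_mul_of_nonneg_left (hA k) (abs_nonneg c)⟩, ?_⟩
  rw [integral_const_mul]
  rw [tendstoInMeasure_iff_measureReal_norm] at hft ⊢
  intro ε hε
  refine squeeze_zero (fun n => measureReal_nonneg) (fun n => ?_)
    (hft (ε / (|c| + 1)) (by positivity))
  refine measureReal_mono ?_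
  intro ω hω
  simp only [Set.mem_ofPred_eq, overlapMean_const_mul] at hω ⊢
  rw [← mul_sub, norm_mul, Real.norm_eq_abs c] at hω
  rw [div_le_iff₀ (by positivity)]
  nlinarith [norm_nonneg (overlapMean f (x n · ω) - ∫ k, f k ∂(poissonMeasure r))]

/-- The majorant k must itself converge: its overlap mean is then close to its Poisson mean, which
bounds the error of replacing f by g on both sides. -/
theorem of_approx (hx : ∀ n e ω, 0 ≤ x n e ω) {f : ℕ → ℝ} (hf : ∃ B, ∀ k, |f k| ≤ B)
    (h : ∀ ε > 0, ∃ g k : ℕ → ℝ, OverlapConverges P x r g ∧ OverlapConverges P x r k ∧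
      (∀ m, |f m - g m| ≤ k m) ∧ ∫ m, k m ∂(poissonMeasure r) ≤ ε) :
    OverlapConverges P x r f := by
  refine ⟨hf, ?_⟩
  rw [tendstoInMeasure_iff_measureReal_norm]
  intro ε hε
  obtain ⟨g, k, ⟨hgb, hg⟩, ⟨hkb, hk⟩, hfg, hkε⟩ := h (ε / 5) (by positivity)
  rw [tendstoInMeasure_iff_measureReal_norm] at hg hk
  have := (hg (ε / 5) (by positivity)).add (hk (ε / 5) (by positivity))
  rw [add_zero] at this
  refine squeeze_zero (fun n => measureReal_nonneg) (fun n => ?_) this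
  refine (measureReal_mono ?_).trans (measureReal_union_le _ _)
  intro ω hω
  by_contra hcon
  simp only [Set.mem_union, Set.mem_ofPred_eq, not_or, not_le, Real.norm_eq_abs] at hcon hω
  obtain ⟨h1, h2⟩ := hcon
  have h3 := abs_overlapMean_sub_le hfg (fun e => hx n e ω)
  have hfi := integrable_poissonMeasure_of_bounded (r := r) hf
  have hgi := integrable_poissonMeasure_of_bounded (r := r) hgb
  have hki := integrable_poissonMeasure_of_bounded (r := r) hkb
  have h4 : |∫ m, f m ∂(poissonMeasure r) - ∫ m, g m ∂(poissonMeasure r)| ≤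
      ∫ m, k m ∂(poissonMeasure r) := by
    rw [← integral_sub hfi hgi]
    exact (abs_integral_le_integral_abs).trans (integral_mono (hfi.sub hgi).abs hki hfg)
  rw [abs_lt] at h1 h2
  rw [abs_le] at h3 h4
  rcases le_abs.1 hω with h5 | h5 <;> linarith

theorem sum {ι : Type*} (s : Finset ι) {f : ι → ℕ → ℝ}
    (h0 : OverlapConverges P x r fun _ => 0) (hf : ∀ i ∈ s, OverlapConverges P x r (f i)) :
    OverlapConverges P x r (fun k => ∑ i ∈ s, f i k) := by
  classical
  induction s using Finset.induction_on with
  | empty => simpa using h0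
  | insert i s hi ih =>
    simp_rw [sum_insert hi]
    exact (hf i (mem_insert_self _ _)).add (ih fun j hj => hf j (mem_insert_of_mem hj))

variable {m3 : ℝ}

theorem pow (h : ∀ n, NormalizedWeights P (x n) r m3) {s : ℝ} (hs : 0 ≤ s) (hs1 : s ≤ 1) :
    OverlapConverges P x r (fun k => s ^ k) := by
  refine ⟨⟨1, fun k => ?_⟩, ?_⟩
  · rw [abs_of_nonneg (by positivity)]
    exact pow_le_one₀ hs hs1
  · rw [integral_pow_poissonMeasure]
    exact tendstoInMeasure_overlapMean_pow h hs

/-- Not immediate: the overlap mean of 1 is Z²/Z², which is 0 when Z = 0. The case s = 1 covers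
this. -/
theorem const (h : ∀ n, NormalizedWeights P (x n) r m3) (c : ℝ) :
    OverlapConverges P x r (fun _ => c) := by
  simpa using (pow h zero_le_one le_rfl).const_mul c

/-- Take s small and subtract from s^m the indicators below k, known by induction. After division by
s^k the result is 0 for m < k, 1 at m = k, and at most s beyond. -/
theorem indicator_eq (h : ∀ n, NormalizedWeights P (x n) r m3) (k : ℕ) :
    OverlapConverges P x r (fun m => if m = k then 1 else 0) := by
  induction k using Nat.strong_induction_on with
  | _ k ih =>
    refine of_approx (fun n e ω => (h n).nonneg e ω) ⟨1, fun m => by split_ifs <;> simp⟩ ?_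
    intro ε hε
    set s := min ε 1 with hs
    have hs0 : 0 < s := lt_min hε one_pos
    have hs1 : s ≤ 1 := min_le_right _ _
    refine ⟨fun m => (s ^ k)⁻¹ * (s ^ m + (-1) * ∑ j ∈ range k, s ^ j * if m = j then 1 else 0),
      fun _ => s, ?_, const h s, fun m => ?_, ?_⟩
    · exact ((pow h hs0.le hs1).add ((sum _ (const h 0) fun j hj =>
        (ih j (mem_range.1 hj)).const_mul (s ^ j)).const_mul (-1))).const_mul _
    · simp only [mul_ite, mul_one, mul_zero, sum_ite_eq, mem_range]
      rcases lt_trichotomy m k with hm | rfl | hm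
      · simp [hm, hm.ne, hs0.le]
      · have : s ^ m ≠ 0 := by positivity
        simp [this, hs0.le]
      · obtain ⟨d, rfl⟩ := Nat.exists_eq_add_of_lt hm
        have e : (s ^ k)⁻¹ * s ^ (k + d + 1) = s ^ (d + 1) := by
          rw [add_assoc, pow_add, inv_mul_cancel_left₀ (by positivity)]
        rw [if_neg (by omega), if_neg (by omega), add_zero, e, zero_sub, abs_neg,
          abs_of_pos (by positivity), pow_succ]
        exact mul_le_of_le_one_left hs0.le (pow_le_one₀ hs0.le hs1)
    · rw [integral_const, probReal_univ, one_smul]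
      exact min_le_left ε 1

theorem tendsto_integral_tail (r : ℝ≥0) :
    Tendsto (fun K : ℕ => ∫ m, (if m < K then (0 : ℝ) else 1) ∂(poissonMeasure r)) atTop
      (𝓝 0) := by
  have := tendsto_integral_of_dominated_convergence (μ := poissonMeasure r)
    (F := fun K m => if m < K then (0 : ℝ) else 1) (f := fun _ => 0) (fun _ => 1)
    (fun K => by fun_prop) (integrable_const _)
    (fun K => Eventually.of_forall fun m => by split_ifs <;> simp)
    (Eventually.of_forall fun m => tendsto_const_nhds.congr' ?_)
  · simpa using this
  · filter_upwards [eventually_gt_atTop m] with K hK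
    rw [if_pos hK]

/-- Truncate f at K. The error is at most B on {m ≥ K}, an event whose indicator is 1 minus finitely
many point indicators, so it converges too. -/
theorem of_bounded (h : ∀ n, NormalizedWeights P (x n) r m3) {f : ℕ → ℝ}
    (hf : ∃ B, ∀ k, |f k| ≤ B) : OverlapConverges P x r f := by
  refine of_approx (fun n e ω => (h n).nonneg e ω) hf fun ε hε => ?_
  obtain ⟨B, hB⟩ := hf
  have hB0 : 0 ≤ B := (abs_nonneg _).trans (hB 0)
  obtain ⟨K, hK⟩ := ((tendsto_integral_tail r).eventually_lt_const
    (by positivity : 0 < ε / (B + 1))).exists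
  have hsum : ∀ (g : ℕ → ℝ) m, (∑ j ∈ range K, g j * if m = j then 1 else 0) =
      if m < K then g m else 0 := fun g m => by simp
  refine ⟨fun m => ∑ j ∈ range K, f j * if m = j then 1 else 0,
    fun m => B * (1 + (-1) * ∑ j ∈ range K, 1 * if m = j then 1 else 0), ?_, ?_, fun m => ?_, ?_⟩
  · exact sum _ (const h 0) fun j _ => (indicator_eq h j).const_mul _
  · exact ((const h 1).add ((sum _ (const h 0) fun j _ =>
      (indicator_eq h j).const_mul _).const_mul _)).const_mul _
  · simp only [hsum f, hsum fun _ => 1]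
    split_ifs
    · simp
    · simpa using hB m
  · simp_rw [hsum fun _ => 1]
    have e : ∀ m, (1 : ℝ) + -1 * (if m < K then 1 else 0) = if m < K then 0 else 1 := fun m => by
      split_ifs <;> simp
    simp_rw [e]
    rw [integral_const_mul]
    rw [lt_div_iff₀ (by positivity)] at hK
    have : 0 ≤ ∫ m, (if m < K then (0 : ℝ) else 1) ∂(poissonMeasure r) :=
      integral_nonneg fun m => by simp only [Pi.zero_apply]; split_ifs <;> simp
    nlinarith

end OverlapConverges

end MMP

/-! ### Boltzmann factors, and translation from the Gibbs measure to permutation averages. -/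

namespace MMP

open Finset Topology

/-- The Boltzmann factor `exp (-β v)` of a weight `v`. -/
noncomputable def boltzmann (β : ℝ) (v : EReal) : ℝ≥0∞ :=
  EReal.exp (-(β : EReal) * v)

theorem boltzmann_eq_rpow (β : ℝ) (v : EReal) : boltzmann β v = EReal.exp v ^ (-β) := by
  rw [boltzmann, mul_comm, ← EReal.coe_neg, EReal.exp_mul]

theorem measurable_boltzmann (β : ℝ) : Measurable (boltzmann β) := by
  simp_rw [funext (boltzmann_eq_rpow β)]
  exact EReal.measurable_exp.pow_const _

theorem boltzmann_nat_mul (β : ℝ) (k : ℕ) (v : EReal) :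
    boltzmann (k * β) v = boltzmann β v ^ k := by
  rw [boltzmann_eq_rpow, boltzmann_eq_rpow, ← ENNReal.rpow_mul_natCast]
  ring_nf

theorem boltzmann_bot {β : ℝ} (hβ : 0 < β) : boltzmann β ⊥ = ⊤ := by
  rw [boltzmann_eq_rpow, EReal.exp_bot, ENNReal.zero_rpow_of_neg (by linarith)]

theorem boltzmann_eq_zero_iff {β : ℝ} (hβ : 0 < β) {v : EReal} : boltzmann β v = 0 ↔ v = ⊤ := by
  rw [boltzmann_eq_rpow, ENNReal.rpow_eq_zero_iff]
  constructor
  · rintro (⟨_, h⟩ | ⟨h, _⟩)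
    · linarith
    · exact EReal.exp_eq_top_iff.1 h
  · rintro rfl
    exact Or.inr ⟨EReal.exp_top, by linarith⟩

/-- The value ⊥ must be excluded: with β > 0, ⊥ + ⊤ = ⊥ has factor ⊤ whereas the product of the
factors is ⊤ * 0 = 0. Hence the induction also carries `EReal.exp` of the sum being nonzero. -/
theorem boltzmann_sum {ι : Type*} (β : ℝ) (s : Finset ι) {w : ι → EReal} (hw : ∀ i, w i ≠ ⊥) :
    boltzmann β (∑ i ∈ s, w i) = ∏ i ∈ s, boltzmann β (w i) := by
  classical
  suffices h : EReal.exp (∑ i ∈ s, w i) ≠ 0 ∧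
      boltzmann β (∑ i ∈ s, w i) = ∏ i ∈ s, boltzmann β (w i) from h.2
  induction s using Finset.induction_on with
  | empty => simp [boltzmann_eq_rpow]
  | insert i s hi ih =>
    have h1 : EReal.exp (w i) ≠ 0 := fun h => hw i (EReal.exp_eq_zero_iff.1 h)
    rw [sum_insert hi, prod_insert hi, ← ih.2, EReal.exp_add]
    refine ⟨mul_ne_zero h1 ih.1, ?_⟩
    rw [boltzmann_eq_rpow, boltzmann_eq_rpow, boltzmann_eq_rpow, EReal.exp_add,
      ENNReal.mul_rpow_of_ne_zero h1 ih.1]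

/-- The set of edges of the perfect matching given by a permutation. -/
def permGraph {n : ℕ} (σ : Equiv.Perm (Fin n)) : Finset (Edge n) :=
  univ.map ⟨fun i => (i, σ i), fun _ _ h => (Prod.ext_iff.1 h).1⟩

theorem mem_permGraph {n : ℕ} {σ : Equiv.Perm (Fin n)} {e : Edge n} :
    e ∈ permGraph σ ↔ σ e.1 = e.2 := by
  rcases e with ⟨i, j⟩
  simp only [permGraph, Finset.mem_map, mem_univ, true_and]
  constructor
  · rintro ⟨a, h⟩
    obtain ⟨rfl, h'⟩ := Prod.ext_iff.1 h
    exact h'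
  · intro h
    exact ⟨i, Prod.ext rfl h⟩

theorem permGraph_injective {n : ℕ} : Function.Injective (permGraph (n := n)) := by
  intro σ τ h
  ext i
  have : (i, σ i) ∈ permGraph τ := h ▸ mem_permGraph.2 rfl
  exact congrArg _ (mem_permGraph.1 this).symm

theorem card_permGraph_inter {n : ℕ} (σ τ : Equiv.Perm (Fin n)) :
    (permGraph σ ∩ permGraph τ).card = #{i | σ i = τ i} := by
  have : permGraph σ ∩ permGraph τ = (univ.filter fun i => σ i = τ i).map
      ⟨fun i => (i, σ i), fun _ _ h => (Prod.ext_iff.1 h).1⟩ := by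
    ext ⟨i, j⟩
    simp only [mem_inter, mem_permGraph, Finset.mem_map, mem_filter, mem_univ, true_and]
    constructor
    · rintro ⟨h1, h2⟩
      exact ⟨i, h1.trans h2.symm, Prod.ext rfl h1⟩
    · rintro ⟨a, h, h'⟩
      obtain ⟨rfl, h''⟩ := Prod.ext_iff.1 h'
      exact ⟨h'', h.symm.trans h''⟩
  rw [this, card_map]

theorem perfectMatchings_eq_map (n : ℕ) :
    perfectMatchings n = univ.map ⟨permGraph, permGraph_injective⟩ := by
  ext M
  simp only [perfectMatchings, mem_filter, mem_univ, true_and, Finset.mem_map,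
    Function.Embedding.coeFn_mk]
  constructor
  · rintro ⟨h1, h2⟩
    choose f hf hf' using h1
    have hinj : Function.Injective f := fun i i' h => by
      have a := hf i
      rw [h] at a
      exact (h2 (f i')).unique a (hf i')
    refine ⟨Equiv.ofBijective f (Finite.injective_iff_bijective.1 hinj), ?_⟩
    ext ⟨i, j⟩
    rw [mem_permGraph]
    constructor
    · rintro h
      have : f i = j := h
      exact this ▸ hf i
    · exact fun h => (hf' i j h).symm
  · rintro ⟨σ, rfl⟩
    refine ⟨fun i => ⟨σ i, mem_permGraph.2 rfl, fun j h => (mem_permGraph.1 h).symm⟩,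
      fun j => ⟨σ.symm j, mem_permGraph.2 (by simp), fun i h => ?_⟩⟩
    exact (Equiv.eq_symm_apply σ).2 (mem_permGraph.1 h)

theorem sum_perfectMatchings {n : ℕ} {A : Type*} [AddCommMonoid A] (F : Finset (Edge n) → A) :
    ∑ M ∈ perfectMatchings n, F M = ∑ σ, F (permGraph σ) := by
  rw [perfectMatchings_eq_map, sum_map]
  rfl

theorem toReal_boltzmann_totalWeight {n : ℕ} (β : ℝ) {w : Edge n → EReal} (hw : ∀ e, w e ≠ ⊥)
    (σ : Equiv.Perm (Fin n)) :
    (boltzmann β (totalWeight w (permGraph σ))).toReal =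
      permWeight (fun e => (boltzmann β (w e)).toReal) σ := by
  rw [totalWeight, boltzmann_sum β _ hw, permGraph, prod_map, ENNReal.toReal_prod]
  rfl

theorem boltzmann_ne_top {β : ℝ} (hβ : 0 < β) {v : EReal} (hv : v ≠ ⊥) : boltzmann β v ≠ ⊤ := by
  rw [boltzmann_eq_rpow]
  intro h
  rcases ENNReal.rpow_eq_top_iff.1 h with ⟨h, _⟩ | ⟨_, h⟩
  · exact hv (EReal.exp_eq_zero_iff.1 h)
  · linarith

theorem toReal_gibbsProb {n : ℕ} {β : ℝ} (hβ : 0 < β) {w : Edge n → EReal} (hw : ∀ e, w e ≠ ⊥)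
    (σ : Equiv.Perm (Fin n)) :
    (gibbsProb β w (permGraph σ)).toReal =
      permWeight (fun e => (boltzmann β (w e)).toReal) σ / n.factorial /
        avgWeight (fun e => (boltzmann β (w e)).toReal) := by
  have h1 : ∀ σ : Equiv.Perm (Fin n), boltzmann β (totalWeight w (permGraph σ)) ≠ ⊤ := fun σ => by
    rw [totalWeight, boltzmann_sum β _ hw]
    exact ENNReal.prod_ne_top fun e _ => boltzmann_ne_top hβ (hw e)
  have h2 : (partitionFunction β w).toReal =
      avgWeight (fun e => (boltzmann β (w e)).toReal) := by
    rw [partitionFunction, sum_perfectMatchings, ENNReal.toReal_mul, ENNReal.toReal_inv,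
      ENNReal.toReal_natCast, avgWeight, permAvg, div_eq_inv_mul]
    congr 1
    refine (ENNReal.toReal_sum fun σ _ => h1 σ).trans ?_
    exact sum_congr rfl fun σ _ => toReal_boltzmann_totalWeight β hw σ
  rw [gibbsProb, ENNReal.toReal_div, h2, ENNReal.toReal_mul, ENNReal.toReal_inv,
    ENNReal.toReal_natCast, div_eq_inv_mul _ (n.factorial : ℝ)]
  congr 2
  exact toReal_boltzmann_totalWeight β hw σ

theorem gibbsProb_ne_top {n : ℕ} (β : ℝ) (w : Edge n → EReal) (σ : Equiv.Perm (Fin n)) :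
    gibbsProb β w (permGraph σ) ≠ ⊤ := by
  refine ne_top_of_le_ne_top ENNReal.one_ne_top (ENNReal.div_le_of_le_mul ?_)
  rw [one_mul, partitionFunction, sum_perfectMatchings]
  gcongr
  exact single_le_sum (f := fun σ => EReal.exp (-(β : EReal) * totalWeight w (permGraph σ)))
    (fun _ _ => zero_le) (mem_univ σ)

/-- Numerator and denominator both scale by m^{-2n}; this is what allows normalising the weights to
mean 1. -/
theorem overlapMean_div {n : ℕ} (f : ℕ → ℝ) (x : Edge n → ℝ) {m : ℝ} (hm : m ≠ 0) :
    overlapMean f (fun e => x e / m) = overlapMean f x := by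
  have h1 : ∀ σ, permWeight (fun e => x e / m) σ = (m ^ n)⁻¹ * permWeight x σ := fun σ => by
    rw [permWeight, prod_div_distrib, prod_const, card_univ, Fintype.card_fin, div_eq_inv_mul]
    rfl
  have h2 : (m ^ n)⁻¹ ≠ 0 := inv_ne_zero (pow_ne_zero _ hm)
  have h3 : avgWeight (fun e => x e / m) = (m ^ n)⁻¹ * avgWeight x := by
    simp_rw [avgWeight, funext h1, permAvg_mul_left]
  have h4 : ∀ ρ τ : Equiv.Perm (Fin n), (m ^ n)⁻¹ * permWeight x ρ * ((m ^ n)⁻¹ * permWeight x τ) *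
      f #{i | ρ i = τ i} =
      ((m ^ n)⁻¹) ^ 2 * (permWeight x ρ * permWeight x τ * f #{i | ρ i = τ i}) := fun ρ τ => by
    ring
  simp_rw [overlapMean, h3, h1, h4, permAvg_mul_left, mul_pow]
  exact mul_div_mul_left _ _ (pow_ne_zero 2 h2)

theorem integral_overlapLaw {n : ℕ} {β : ℝ} (hβ : 0 < β) {w : Edge n → EReal}
    (hw : ∀ e, w e ≠ ⊥) {f : ℕ → ℝ} (hf : ∃ B, ∀ k, |f k| ≤ B) :
    ∫ k, f k ∂(overlapLaw β w) = overlapMean f fun e => (boltzmann β (w e)).toReal := by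
  obtain ⟨B, hB⟩ := hf
  have hfin : ∀ ρ τ : Equiv.Perm (Fin n),
      gibbsProb β w (permGraph ρ) * gibbsProb β w (permGraph τ) ≠ ⊤ := fun ρ τ =>
    ENNReal.mul_ne_top (gibbsProb_ne_top β w ρ) (gibbsProb_ne_top β w τ)
  have hint : ∀ ρ τ : Equiv.Perm (Fin n), Integrable f
      ((gibbsProb β w (permGraph ρ) * gibbsProb β w (permGraph τ)) •
        Measure.dirac (permGraph ρ ∩ permGraph τ).card) := fun ρ τ =>
    (Integrable.of_bound (by fun_prop) B (Eventually.of_forall hB)).smul_measure (hfin ρ τ)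
  simp_rw [overlapLaw, sum_perfectMatchings]
  rw [integral_finsetSum_measure fun ρ _ => integrable_finsetSum_measure.2 fun τ _ => hint ρ τ]
  simp_rw [fun ρ => integral_finsetSum_measure fun τ (_ : τ ∈ univ) => hint ρ τ,
    integral_smul_measure, integral_dirac, ENNReal.toReal_mul, toReal_gibbsProb hβ hw,
    card_permGraph_inter, smul_eq_mul]
  simp only [overlapMean, permAvg, sum_div]
  refine sum_congr rfl fun ρ _ => sum_congr rfl fun τ _ => ?_
  ring

section Moments

variable {μ : Measure EReal} {β : ℝ}

/-- The k-th moment at β is the first moment at kβ, so finiteness of ψ on (0, ∞) supplies the second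
and third moments. -/
theorem lintegral_boltzmann_pow_lt_top (hpsi : ∀ β : ℝ, 0 < β → psi μ β < ⊤) (hβ : 0 < β) {k : ℕ}
    (hk : 0 < k) : ∫⁻ v, boltzmann β v ^ k ∂μ < ⊤ := by
  have h : psi μ (k * β) < ⊤ := hpsi _ (by positivity)
  have e : psi μ (k * β) = ENNReal.log (∫⁻ v, boltzmann (k * β) v ∂μ) := rfl
  rw [e, ENNReal.log_lt_top_iff] at h
  simpa only [boltzmann_nat_mul] using h

theorem lintegral_boltzmann_ne_zero [IsProbabilityMeasure μ] (hβ : 0 < β) (htop : μ {⊤} < 1) :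
    ∫⁻ v, boltzmann β v ∂μ ≠ 0 := by
  intro h
  rw [lintegral_eq_zero_iff (measurable_boltzmann β)] at h
  have h1 : ∀ᵐ v ∂μ, v ∈ ({⊤} : Set EReal) := by
    filter_upwards [h] with v hv
    exact (boltzmann_eq_zero_iff hβ).1 hv
  exact htop.ne ((mem_ae_iff_prob_eq_one (measurableSet_singleton ⊤)).1 h1)

theorem overlapRate_eq (μ : Measure EReal) (β : ℝ) :
    overlapRate μ β =
      ((∫⁻ v, boltzmann β v ^ 2 ∂μ) / (∫⁻ v, boltzmann β v ∂μ) ^ 2).toNNReal := by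
  have h1 : psi μ (2 * β) = ENNReal.log (∫⁻ v, boltzmann β v ^ 2 ∂μ) := by
    simp_rw [← boltzmann_nat_mul]
    rfl
  have h2 : 2 * psi μ β = ENNReal.log ((∫⁻ v, boltzmann β v ∂μ) ^ 2) := by
    rw [ENNReal.log_pow]
    rfl
  rw [overlapRate, h1, h2, sub_eq_add_neg, EReal.exp_add, EReal.exp_neg, ENNReal.exp_log,
    ENNReal.exp_log, div_eq_mul_inv]

variable {Ω : Type*} [MeasurableSpace Ω] {P : Measure Ω}

theorem integral_toReal_boltzmann_pow (hpsi : ∀ β : ℝ, 0 < β → psi μ β < ⊤) (hβ : 0 < β)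
    {X : Ω → EReal} (hX : HasLaw X μ P) {k : ℕ} (hk : 0 < k) :
    Integrable (fun ω => (boltzmann β (X ω)).toReal ^ k) P ∧
      ∫ ω, (boltzmann β (X ω)).toReal ^ k ∂P = (∫⁻ v, boltzmann β v ^ k ∂μ).toReal := by
  have hm : Measurable fun v => boltzmann β v ^ k := (measurable_boltzmann β).pow_const k
  have hmX : AEMeasurable (fun ω => boltzmann β (X ω) ^ k) P := hm.comp_aemeasurable hX.aemeasurable
  have e : ∫⁻ ω, boltzmann β (X ω) ^ k ∂P = ∫⁻ v, boltzmann β v ^ k ∂μ := by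
    rw [← hX.map_eq, lintegral_map' hm.aemeasurable hX.aemeasurable]
  have hlt := lintegral_boltzmann_pow_lt_top hpsi hβ hk
  rw [← e] at hlt ⊢
  simp_rw [← ENNReal.toReal_pow]
  exact ⟨integrable_toReal_of_lintegral_ne_top hmX hlt.ne,
    integral_toReal hmX (ae_lt_top' hmX hlt.ne)⟩

theorem normalizedWeights_boltzmann [IsProbabilityMeasure μ] {n : ℕ} {w : Edge n → Ω → EReal}
    (hlaw : ∀ e, HasLaw (w e) μ P) (hindep : iIndepFun w P)
    (hpsi : ∀ β : ℝ, 0 < β → psi μ β < ⊤) (htop : μ {⊤} < 1) (hβ : 0 < β) :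
    NormalizedWeights P
      (fun e ω => (boltzmann β (w e ω)).toReal / (∫⁻ v, boltzmann β v ∂μ).toReal)
      (overlapRate μ β)
      ((∫⁻ v, boltzmann β v ^ 3 ∂μ).toReal / (∫⁻ v, boltzmann β v ∂μ).toReal ^ 3) := by
  set m := (∫⁻ v, boltzmann β v ∂μ).toReal with hm
  have hlt : ∫⁻ v, boltzmann β v ∂μ < ⊤ := by
    simpa using lintegral_boltzmann_pow_lt_top hpsi hβ one_pos
  have hm0 : m ≠ 0 := (ENNReal.toReal_pos (lintegral_boltzmann_ne_zero hβ htop) hlt.ne).ne'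
  have hmeas : Measurable fun v => (boltzmann β v).toReal / m :=
    (measurable_boltzmann β).ennreal_toReal.div_const m
  have hk : ∀ e (k : ℕ), 0 < k →
      Integrable (fun ω => ((boltzmann β (w e ω)).toReal / m) ^ k) P ∧
      ∫ ω, ((boltzmann β (w e ω)).toReal / m) ^ k ∂P =
        (∫⁻ v, boltzmann β v ^ k ∂μ).toReal / m ^ k := by
    intro e k hk
    obtain ⟨h1, h2⟩ := integral_toReal_boltzmann_pow hpsi hβ (hlaw e) hk
    simp_rw [div_pow]
    exact ⟨h1.div_const _, by rw [integral_div, h2]⟩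
  refine ⟨fun e => hmeas.comp_aemeasurable (hlaw e).aemeasurable, ?_, fun e ω => by positivity,
    fun e => ?_, fun e => (hk e 2 two_pos).1, fun e => (hk e 3 three_pos).1, fun e => ?_,
    fun e => ?_, fun e => (hk e 3 three_pos).2⟩
  · exact hindep.comp (fun _ v => (boltzmann β v).toReal / m) fun _ => hmeas
  · simpa using (hk e 1 one_pos).1
  · have := (hk e 1 one_pos).2
    simp only [pow_one] at this
    rw [this, ← hm, div_self hm0]
  · rw [(hk e 2 two_pos).2, overlapRate_eq, hm, ENNReal.coe_toNNReal_eq_toReal,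
      ENNReal.toReal_div, ENNReal.toReal_pow]

end Moments

end MMP

theorem theorem1p2 {Ω : Type*} [MeasurableSpace Ω] (P : Measure Ω) [IsProbabilityMeasure P]
    (μ : Measure EReal) [IsProbabilityMeasure μ]
    (w : (n : ℕ) → MMP.Edge n → Ω → EReal)
    (hlaw : ∀ n e, HasLaw (w n e) μ P)
    (hindep : ∀ n, iIndepFun (w n) P)
    (hpsi : ∀ β : ℝ, 0 < β → MMP.psi μ β < ⊤)
    (htop : μ {⊤} < 1)
    (β : ℝ) (hβ : 0 < β) :
    MMP.TendstoWeaklyInProbability P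
      (fun n a => MMP.overlapLaw β (fun e => w n e a))
      (poissonMeasure (MMP.overlapRate μ β)) := by
  intro f
  have hf : ∃ B, ∀ k, |f k| ≤ B := ⟨‖f‖, fun k => f.norm_coe_le_norm k⟩
  have hlt : ∫⁻ v, MMP.boltzmann β v ∂μ < ⊤ := by
    simpa using MMP.lintegral_boltzmann_pow_lt_top hpsi hβ one_pos
  have hm0 := (ENNReal.toReal_pos (MMP.lintegral_boltzmann_ne_zero hβ htop) hlt.ne).ne'
  refine (MMP.OverlapConverges.of_bounded (fun n => MMP.normalizedWeights_boltzmann (hlaw n)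
    (hindep n) hpsi htop hβ) hf).2.congr_left fun n => ?_
  -- The law lives on all of `EReal`, but mass at ⊥ would make the Boltzmann factor infinite with
  -- positive probability, against ψ(β) < ∞.
  have hbot : ∀ᵐ v ∂μ, v ≠ ⊥ := by
    filter_upwards [ae_lt_top (MMP.measurable_boltzmann β) hlt.ne] with v hv h
    rw [h, MMP.boltzmann_bot hβ] at hv
    exact lt_irrefl _ hv
  have hw : ∀ᵐ a ∂P, ∀ e, w n e a ≠ ⊥ := by
    rw [ae_all_iff]
    intro e
    refine ae_of_ae_map (p := fun v => v ≠ ⊥) (hlaw n e).aemeasurable ?_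
    rwa [(hlaw n e).map_eq]
  filter_upwards [hw] with a ha
  rw [MMP.integral_overlapLaw hβ ha hf]
  exact MMP.overlapMean_div f (fun e => (MMP.boltzmann β (w n e a)).toReal) hm0
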